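/- **Conventions.** An $\ell$-algebra is a commutative unital $\mathbb R$-algebra $A$ with a lattice order such that $a\le b$ implies $a+c\le b+c$; $0\le a,b$ implies $0\le ab$; and $0\le r\in\mathbb R$, $0\le a$ imply $0\le ra$. It is *bounded* if every $a$ satisfies $a\le n\cdot 1$ for some $n\in\mathbb N$, and *archimedean* if $na\le b$ for all $n\in\mathbb N$ implies $a\le 0$. Write $a^+=a\vee 0$, $|a|=a\vee(-a)$, $\|a\|=\inf\{r\in\mathbb R: |a|\le r\cdot 1\}$, and identify $r\in\mathbb R$ with $r\cdot 1\in A$. Let $\boldsymbol{ba\ell}$ be the category of bounded archimedean $\ell$-algebras and unital $\mathbb R$-algebra homomorphisms that preserve $\vee$ and $\wedge$; $A\in\boldsymbol{ba\ell}$ is *uniformly complete* if every sequence that is Cauchy for $\|\cdot\|$ converges for $\|\cdot\|$. A *modal operator* on $A\in\boldsymbol{ba\ell}$ is a function $\Box:A\to A$ such that, for all $a,b\in A$ and $r\in\mathbb R$: (M1) $\Box(a\wedge b)=\Box a\wedge\Box b$; (M2) $\Box r=r+(1-r)\Box 0$; (M3) $\Box(a^+)=(\Box a)^+$; (M4) $\Box(a+r)=\Box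 a+\Box r-\Box 0$; (M5) $\Box(ra)=(\Box r)(\Box a)$ if $r\ge 0$. Let $\boldsymbol{mba\ell}$ be the category of pairs $(A,\Box)$ with $A\in\boldsymbol{ba\ell}$ and $\Box$ a modal operator on $A$, with $\boldsymbol{ba\ell}$-morphisms commuting with $\Box$, and let $\boldsymbol{muba\ell}$ be its full subcategory of pairs with $A$ uniformly complete. A relation $R$ on a compact Hausdorff space $X$ is *continuous* if $R[x]=\{y: xRy\}$ is closed for every $x\in X$, $R^{-1}[F]$ is closed for every closed $F\subseteq X$, and $R^{-1}[U]$ is open for every open $U\subseteq X$. Let $\mathsf{KHF}$ be the category of pairs $(X,R)$ with $X$ compact Hausdorff and $R$ continuous; its morphisms $(X,R)\to(Y,S)$ are the continuous maps $f$ with $f(R[x])=S[f(x)]$ for all $x\in X$. For $A\in\boldsymbol{ba\ell}$ let $Y_A$ be the set of maximal (proper) $\ell$-ideals of $A$ (an ideal $I$ is an $\ell$-ideal if $|a|\le|b|$, $b\in I$ imply $a\in I$), with closed sets $\{M\in Y_A: I\subseteq M\}$, $I$ an $\ell$-ideal; it is a compact Hausdorff space. For compact Hausdorff $X$ let $C(X)\in\boldsymbol{ba\ell}$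 be the algebra of continuous functions $X\to\mathbb R$. For a $\boldsymbol{ba\ell}$-morphism $\alpha$ put $\mathsf Y(\alpha)=\alpha^{-1}$, and for a continuous map $\varphi$ put $\mathsf C(\varphi)(f)=f\circ\varphi$. Let $\zeta_A:A\to C(Y_A)$, where $\zeta_A(a)(M)$ is the unique $r\in\mathbb R$ with $a+M=r+M$, and $\varepsilon_X:X\to Y_{C(X)}$, $\varepsilon_X(x)=\{f: f(x)=0\}$. Define contravariant functors $\mathsf Y:\boldsymbol{mba\ell}\to\mathsf{KHF}$, $\mathsf Y(A,\Box)=(Y_A,R_\Box)$, where $xR_\Box y$ iff $\Box a\in x$ for all $0\le a\in y$, and $\mathsf C:\mathsf{KHF}\to\boldsymbol{mba\ell}$, $\mathsf C(X,R)=(C(X),\Box_R)$, where $(\Box_R f)(x)=\inf f(R[x])$ if $R[x]\neq\varnothing$ and $(\Box_R f)(x)=1$ otherwise; on morphisms they are $\alpha\mapsto\alpha^{-1}$ and $\varphi\mapsto(f\mapsto f\circ\varphi)$. Let $\mathsf H:\boldsymbol{ba\ell}\to\boldsymbol{ba\ell}$ send $A$ to $F(A)/I_A$, where $F(A)$ is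 the free object of $\boldsymbol{ba\ell}$ over the set $A$ with the weight function $w_A(a)=\max\{\|a\|,1\}$ (so that maps $g:A\to B\in\boldsymbol{ba\ell}$ with $\|g(a)\|\le w_A(a)$ extend uniquely to morphisms $F(A)\to B$), and $I_A$ is the least $\ell$-ideal with archimedean quotient that contains the elements expressing (M1)–(M5) for the generators; write $\Box_a\in\mathsf H(A)$ for the class of the generator $a$, and let $\mathsf H(\alpha)(\Box_a)=\Box_{\alpha(a)}$. Let $\mathsf V$ be the Vietoris endofunctor of compact Hausdorff spaces: $\mathsf V(X)$ is the space of all closed subsets of $X$ (including $\varnothing$) with the Vietoris topology, and $\mathsf V(\varphi)(K)=\varphi(K)$. Let $\eta_A:\mathsf H(A)\to C(\mathsf V(Y_A))$ be the morphism with $\eta_A(\Box_a)(K)=\inf\zeta_A(a)(K)$ for $K\ne\varnothing$ and $\eta_A(\Box_a)(\varnothing)=1$; then $\mathsf Y(\eta_A)$ is a homeomorphism. Let $\mathsf{Alg}(\mathsf H)$ and $\mathsf{Coalg}(\mathsf V)$ be the categories of algebras for $\mathsf H$ and coalgebras for $\mathsf V$, and define * $\mathsf M:\mathsf{Alg}(\mathsf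 H)\to\boldsymbol{mba\ell}$, $(A,\alpha)\mapsto(A,\,a\mapsto\alpha(\Box_a))$, and $\mathsf N:\boldsymbol{mba\ell}\to\mathsf{Alg}(\mathsf H)$, $(A,\Box)\mapsto(A,\sigma_\Box)$ with $\sigma_\Box(\Box_a)=\Box a$, both being the identity on underlying morphisms; * contravariant $\mathsf F:\mathsf{Alg}(\mathsf H)\to\mathsf{Coalg}(\mathsf V)$, $(A,\alpha)\mapsto(Y_A,\ \varepsilon_{\mathsf V(Y_A)}^{-1}\circ\mathsf Y(\eta_A)^{-1}\circ\mathsf Y(\alpha))$, and $\mathsf G:\mathsf{Coalg}(\mathsf V)\to\mathsf{Alg}(\mathsf H)$, $(X,\sigma)\mapsto(C(X),\ \mathsf C(\sigma)\circ \mathsf C(\mathsf V(\varepsilon_X))\circ\eta_{C(X)})$, acting as $\mathsf Y$ and $\mathsf C$ on underlying morphisms; * $\mathsf S:\mathsf{Coalg}(\mathsf V)\to\mathsf{KHF}$, $(X,\sigma)\mapsto(X,R_\sigma)$ with $xR_\sigma y$ iff $y\in\sigma(x)$, and $\mathsf T:\mathsf{KHF}\to\mathsf{Coalg}(\mathsf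 V)$, $(X,R)\mapsto(X,\ x\mapsto R[x])$, both being the identity on underlying morphisms. **Theorem.** 1. The contravariant functors $\mathsf Y$ and $\mathsf C$ form a dual adjunction between $\boldsymbol{mba\ell}$ and $\mathsf{KHF}$: $\mathsf Y:\boldsymbol{mba\ell}\to\mathsf{KHF}^{\mathrm{op}}$ is left adjoint to $\mathsf C:\mathsf{KHF}^{\mathrm{op}}\to\boldsymbol{mba\ell}$, with unit $\zeta_A:(A,\Box)\to\mathsf C\mathsf Y(A,\Box)$ and counit given by $\varepsilon_X:(X,R)\to\mathsf Y\mathsf C(X,R)$. 2. This dual adjunction restricts to a dual equivalence between $\boldsymbol{muba\ell}$ and $\mathsf{KHF}$: $\mathsf C$ takes values in $\boldsymbol{muba\ell}$, the unit is an isomorphism at every object of $\boldsymbol{muba\ell}$, the counit is an isomorphism at every object, and $\mathsf Y|_{\boldsymbol{muba\ell}}$ and $\mathsf C$ are the two functors of an equivalence $\boldsymbol{muba\ell}\simeq\mathsf{KHF}^{\mathrm{op}}$. 3. $\mathsf S\circ\mathsf F\circ\mathsf N=\mathsf Y$ and $\mathsf M\circ\mathsf G\circ\mathsf T=\mathsf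 C$. -/

import Mathlib

universe u

set_option linter.unusedSectionVars false

open CategoryTheory

namespace ModalBal

attribute [-instance] CategoryTheory.catToReflQuiver

/-! ### Bounded archimedean lattice-ordered algebras -/

/-- `A` is a bounded archimedean `ℓ`-algebra. -/
class IsBal (A : Type u) [CommRing A] [Algebra ℝ A] [Lattice A] : Prop where
  add_le_add : ∀ a b c : A, a ≤ b → a + c ≤ b + c
  mul_nonneg : ∀ a b : A, 0 ≤ a → 0 ≤ b → 0 ≤ a * b
  smul_nonneg : ∀ (r : ℝ) (a : A), 0 ≤ r → 0 ≤ a → 0 ≤ r • a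
  bounded : ∀ a : A, ∃ n : ℕ, a ≤ n • (1 : A)
  archimedean : ∀ a b : A, (∀ n : ℕ, n • a ≤ b) → a ≤ 0

section Basic

variable {A : Type u} [CommRing A] [Algebra ℝ A] [Lattice A] [IsBal A]

instance : IsOrderedAddMonoid A where
  add_le_add_left a b h c := IsBal.add_le_add a b c h

theorem half_nonneg {a : A} (h : 0 ≤ a + a) : 0 ≤ a := by
  have := IsBal.smul_nonneg (1/2 : ℝ) _ (by norm_num) h
  rwa [← two_smul ℝ a, smul_smul, one_div, inv_mul_cancel₀ (by norm_num), one_smul] at this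

instance : ZeroLEOneClass A where
  zero_le_one := by
    obtain ⟨n, hn⟩ := IsBal.bounded (A := A) |1|
    have h0 : (0 : A) ≤ n • 1 := (abs_nonneg _).trans hn
    rcases Nat.eq_zero_or_pos n with rfl | hp
    · rw [zero_smul] at hn
      exact neg_nonpos.1 ((neg_le_abs (1 : A)).trans hn)
    · have := IsBal.smul_nonneg ((n : ℝ)⁻¹) _ (by positivity) h0
      rwa [← Nat.cast_smul_eq_nsmul ℝ, smul_smul, inv_mul_cancel₀ (by positivity), one_smul] at this

instance : IsOrderedRing A := IsOrderedRing.of_mul_nonneg IsBal.mul_nonneg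

theorem algebraMap_mono {r s : ℝ} (h : r ≤ s) : algebraMap ℝ A r ≤ algebraMap ℝ A s := by
  have := IsBal.smul_nonneg (s - r) (1 : A) (sub_nonneg.2 h) zero_le_one
  rwa [← Algebra.algebraMap_eq_smul_one, map_sub, sub_nonneg] at this

theorem abs_mul_le (a b : A) : |a * b| ≤ |a| * |b| := by
  have key : ∀ a b : A, a * b ≤ |a| * |b| := fun a b => by
    have h1 := mul_nonneg (sub_nonneg.2 (le_abs_self a))
      (neg_le_iff_add_nonneg'.1 (neg_le_abs b) : 0 ≤ b + |b|)
    have h2 := mul_nonneg (neg_le_iff_add_nonneg'.1 (neg_le_abs a) : 0 ≤ a + |a|)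
      (sub_nonneg.2 (le_abs_self b))
    have := add_nonneg h1 h2
    rw [← sub_nonneg]
    apply half_nonneg
    convert this using 1
    ring
  refine sup_le (key a b) ?_
  have := key (-a) b
  rwa [abs_neg, neg_mul] at this

theorem mul_eq_zero_of_inf {a b : A} (h : a ⊓ b = 0) : a * b = 0 := by
  have ha : 0 ≤ a := h ▸ inf_le_left
  have hb : 0 ≤ b := h ▸ inf_le_right
  obtain ⟨n, hn⟩ := IsBal.bounded a
  obtain ⟨m, hm⟩ := IsBal.bounded b
  have h1 : a * b ≤ (n + m) • b :=
    (mul_le_mul_of_nonneg_right hn hb).trans (by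
      rw [smul_mul_assoc, one_mul]; exact nsmul_le_nsmul_left hb (by omega))
  have h2 : a * b ≤ (n + m) • a :=
    (mul_le_mul_of_nonneg_left hm ha).trans (by
      rw [mul_smul_comm, mul_one]; exact nsmul_le_nsmul_left ha (by omega))
  have h3 : ∀ k : ℕ, (k • a) ⊓ (k • b) ≤ 0 := fun k => by
    rcases Nat.eq_zero_or_pos k with rfl | hp
    · simp
    have e : ∀ x : A, (k : ℝ)⁻¹ • (k • x) = x := fun x => by
      rw [← Nat.cast_smul_eq_nsmul ℝ, smul_smul, inv_mul_cancel₀ (by positivity), one_smul]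
    have mono : ∀ x y : A, x ≤ y → (k : ℝ)⁻¹ • x ≤ (k : ℝ)⁻¹ • y := fun x y hxy => by
      rw [← sub_nonneg, ← smul_sub]
      exact IsBal.smul_nonneg _ _ (by positivity) (sub_nonneg.2 hxy)
    have : (k : ℝ)⁻¹ • ((k • a) ⊓ (k • b)) ≤ a ⊓ b :=
      le_inf ((mono _ _ inf_le_left).trans_eq (e a)) ((mono _ _ inf_le_right).trans_eq (e b))
    rw [h] at this
    have h4 := nsmul_le_nsmul_right this k
    rwa [smul_zero, ← Nat.cast_smul_eq_nsmul ℝ, smul_smul, mul_inv_cancel₀ (by positivity),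
      one_smul] at h4
  exact le_antisymm ((le_inf h2 h1).trans (h3 _)) (mul_nonneg ha hb)

end Basic

/-- An object of the category `baℓ`. -/
structure BAL : Type (u + 1) where
  carrier : Type u
  [commRing : CommRing carrier]
  [algebra : Algebra ℝ carrier]
  [lattice : Lattice carrier]
  [isBal : IsBal carrier]

namespace BAL

instance : CoeSort BAL.{u} (Type u) := ⟨BAL.carrier⟩

attribute [instance] commRing algebra lattice isBal

/-- A unital `ℓ`-algebra morphism. -/
@[ext]
structure Hom (A B : BAL.{u}) : Type u where
  hom : A →ₐ[ℝ] B
  map_sup : ∀ a b : A, hom (a ⊔ b) = hom a ⊔ hom b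
  map_inf : ∀ a b : A, hom (a ⊓ b) = hom a ⊓ hom b

instance : Category BAL.{u} where
  Hom := Hom
  id A := ⟨AlgHom.id ℝ A, fun _ _ => rfl, fun _ _ => rfl⟩
  comp f g := ⟨g.hom.comp f.hom, fun a b => by simp [f.map_sup, g.map_sup],
    fun a b => by simp [f.map_inf, g.map_inf]⟩

@[ext]
theorem hom_ext {A B : BAL.{u}} {f g : A ⟶ B} (h : ∀ a, f.hom a = g.hom a) : f = g :=
  Hom.ext (AlgHom.ext h)

@[simp] theorem id_hom (A : BAL.{u}) (a : A) : Hom.hom (𝟙 A) a = a := rfl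

@[simp] theorem comp_hom {A B D : BAL.{u}} (f : A ⟶ B) (g : B ⟶ D) (a : A) :
    (f ≫ g).hom a = g.hom (f.hom a) := rfl

theorem Hom.mono {A B : BAL.{u}} (f : A ⟶ B) {a b : A} (h : a ≤ b) : f.hom a ≤ f.hom b := by
  rw [← sup_eq_right, ← f.map_sup, sup_eq_right.2 h]

theorem Hom.map_abs {A B : BAL.{u}} (f : A ⟶ B) (a : A) : f.hom |a| = |f.hom a| := by
  simp [abs, f.map_sup]

end BAL

/-- The norm `‖a‖ = inf {r ∈ ℝ | |a| ≤ r · 1}`. -/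
noncomputable def balNorm {A : Type u} [CommRing A] [Algebra ℝ A] [Lattice A] (a : A) : ℝ :=
  sInf {r : ℝ | |a| ≤ r • (1 : A)}

/-- Completeness of the norm. -/
def IsUniformlyComplete (A : Type u) [CommRing A] [Algebra ℝ A] [Lattice A] : Prop :=
  ∀ s : ℕ → A, (∀ ε : ℝ, 0 < ε → ∃ N, ∀ m ≥ N, ∀ n ≥ N, balNorm (s m - s n) < ε) →
    ∃ a : A, ∀ ε : ℝ, 0 < ε → ∃ N, ∀ n ≥ N, balNorm (s n - a) < ε

/-! ### The Yosida space -/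

section Yosida

variable {A : Type u} [CommRing A] [Algebra ℝ A] [Lattice A]

/-- An `ℓ`-ideal. -/
def IsLIdeal (I : Ideal A) : Prop := ∀ a b : A, |a| ≤ |b| → b ∈ I → a ∈ I

variable (A) in
/-- The set of maximal (proper) `ℓ`-ideals of `A`. -/
def Yosida : Type u := {M : Ideal A // Maximal (fun I => IsLIdeal I ∧ I ≠ ⊤) M}

namespace Yosida

instance : Membership A (Yosida A) := ⟨fun M a => a ∈ M.1⟩

@[ext]
theorem ext {M N : Yosida A} (h : ∀ a, a ∈ M ↔ a ∈ N) : M = N := Subtype.ext (Ideal.ext h)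

variable [IsBal A]

theorem solid (M : Yosida A) {a b : A} (h : |a| ≤ |b|) (hb : b ∈ M) : a ∈ M := M.2.1.1 a b h hb

theorem one_notMem (M : Yosida A) : (1 : A) ∉ M := fun h =>
  M.2.1.2 ((Ideal.eq_top_iff_one _).2 h)

theorem solid' (M : Yosida A) {a b : A} (h0 : 0 ≤ a) (h : a ≤ b) (hb : b ∈ M) : a ∈ M :=
  M.solid (by rwa [abs_of_nonneg h0, abs_of_nonneg (h0.trans h)]) hb

theorem abs_mem (M : Yosida A) {a : A} : |a| ∈ M ↔ a ∈ M :=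
  ⟨M.solid (by rw [abs_abs]), M.solid (by rw [abs_abs])⟩

end Yosida

variable [IsBal A]

/-- The `ℓ`-ideal generated by an `ℓ`-ideal and one element. -/
def adjoin (I : Ideal A) (x : A) : Ideal A where
  carrier := {y | ∃ m ∈ I, 0 ≤ m ∧ ∃ k : ℕ, |y| ≤ m + k • |x|}
  zero_mem' := ⟨0, I.zero_mem, le_rfl, 0, by simp⟩
  add_mem' := by
    rintro a b ⟨m, hm, hm0, k, h⟩ ⟨m', hm', hm0', k', h'⟩
    refine ⟨m + m', I.add_mem hm hm', add_nonneg hm0 hm0', k + k', (abs_add_le _ _).trans ?_⟩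
    calc |a| + |b| ≤ (m + k • |x|) + (m' + k' • |x|) := add_le_add h h'
      _ = _ := by rw [add_smul]; abel
  smul_mem' := by
    rintro c y ⟨m, hm, hm0, k, h⟩
    obtain ⟨n, hn⟩ := IsBal.bounded |c|
    refine ⟨n • m, nsmul_mem hm _, nsmul_nonneg hm0 _, n * k, (abs_mul_le _ _).trans ?_⟩
    calc |c| * |y| ≤ (n • 1) * (m + k • |x|) :=
          mul_le_mul hn h (abs_nonneg _) ((abs_nonneg _).trans hn)
      _ = _ := by rw [smul_mul_assoc, one_mul, smul_add, mul_smul]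

theorem adjoin_isLIdeal (I : Ideal A) (x : A) : IsLIdeal (adjoin I x) := by
  rintro a b h ⟨m, hm, hm0, k, hb⟩
  exact ⟨m, hm, hm0, k, h.trans hb⟩

theorem mem_adjoin (I : Ideal A) (x : A) : x ∈ adjoin I x :=
  ⟨0, I.zero_mem, le_rfl, 1, by simp⟩

theorem le_adjoin {I : Ideal A} (hI : IsLIdeal I) (x : A) : I ≤ adjoin I x := fun y hy =>
  ⟨|y|, hI _ _ (by rw [abs_abs]) hy, abs_nonneg _, 0, by simp⟩

theorem exists_yosida {I : Ideal A} (hI : IsLIdeal I) (h1 : (1 : A) ∉ I) :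
    ∃ M : Yosida A, I ≤ M.1 := by
  obtain ⟨M, hIM, hM⟩ := zorn_le_nonempty₀ {J : Ideal A | IsLIdeal J ∧ J ≠ ⊤}
    (fun c hc hchain J hJ => by
      have hdir := hchain.directedOn
      refine ⟨sSup c, ⟨?_, ?_⟩, fun K hK => le_sSup hK⟩
      · intro a b hab hb
        obtain ⟨K, hK, hbK⟩ := (Submodule.mem_sSup_of_directed ⟨J, hJ⟩ hdir).1 hb
        exact (Submodule.mem_sSup_of_directed ⟨J, hJ⟩ hdir).2 ⟨K, hK, (hc hK).1 a b hab hbK⟩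
      · rw [Ne, Ideal.eq_top_iff_one]
        intro h
        obtain ⟨K, hK, hbK⟩ := (Submodule.mem_sSup_of_directed ⟨J, hJ⟩ hdir).1 h
        exact (hc hK).2 ((Ideal.eq_top_iff_one _).2 hbK))
    I ⟨hI, fun h => h1 (h ▸ Submodule.mem_top)⟩
  exact ⟨⟨M, hM⟩, hIM⟩

namespace Yosida

variable (M : Yosida A)

theorem exists_one_le {x : A} (hx : x ∉ M) : ∃ m ∈ M, 0 ≤ m ∧ ∃ k : ℕ, 1 ≤ m + k • |x| := by
  have h : adjoin M.1 x = ⊤ := by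
    by_contra h
    exact hx (M.2.2 ⟨adjoin_isLIdeal _ _, h⟩ (le_adjoin M.2.1.1 x) (mem_adjoin _ _))
  obtain ⟨m, hm, hm0, k, hk⟩ := (Ideal.eq_top_iff_one _).1 h
  exact ⟨m, hm, hm0, k, (le_abs_self _).trans hk⟩

theorem mem_or_mem_of_inf {a b : A} (h : a ⊓ b = 0) : a ∈ M ∨ b ∈ M := by
  by_contra! hab
  have ha : 0 ≤ a := h ▸ inf_le_left
  have hb : 0 ≤ b := h ▸ inf_le_right
  obtain ⟨m, hm, hm0, k, hk⟩ := M.exists_one_le hab.1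
  refine hab.2 (M.solid' (b := m * b) hb ?_ (M.1.mul_mem_right _ hm))
  have := mul_le_mul_of_nonneg_right hk hb
  rwa [one_mul, add_mul, abs_of_nonneg ha, smul_mul_assoc, mul_eq_zero_of_inf h, smul_zero,
    add_zero] at this

theorem sup_inf_sup_zero (a : A) : (a ⊔ 0) ⊓ (-a ⊔ 0) = 0 := by
  have := posPart_inf_negPart_eq_zero a
  rwa [posPart_def, negPart_def] at this

theorem exists_real (a : A) : ∃ r : ℝ, a - algebraMap ℝ A r ∈ M := by
  have hreal : ∀ {c : ℝ}, 0 < c → algebraMap ℝ A c ∉ M := fun {c} hc h => M.one_notMem (by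
    have := M.1.mul_mem_left (algebraMap ℝ A c⁻¹) h
    rwa [← map_mul, inv_mul_cancel₀ hc.ne', map_one] at this)
  let S : Set ℝ := {s | (a - algebraMap ℝ A s) ⊔ 0 ∈ M}
  have hup : ∀ {s t : ℝ}, s ∈ S → s ≤ t → t ∈ S := fun hs hst =>
    M.solid' le_sup_right (sup_le_sup_right (sub_le_sub_left (algebraMap_mono hst) _) _) hs
  have hor : ∀ s : ℝ, s ∈ S ∨ (algebraMap ℝ A s - a) ⊔ 0 ∈ M := fun s => by
    have := M.mem_or_mem_of_inf (sup_inf_sup_zero (a - algebraMap ℝ A s))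
    rwa [neg_sub] at this
  obtain ⟨n, hn⟩ := IsBal.bounded |a|
  have hn' : |a| ≤ algebraMap ℝ A n := by simpa using hn
  have hS1 : (n : ℝ) ∈ S := by
    have : (a - algebraMap ℝ A n) ⊔ 0 = 0 :=
      sup_eq_right.2 (sub_nonpos.2 ((le_abs_self a).trans hn'))
    change _ ⊔ _ ∈ M
    rw [this]
    exact M.1.zero_mem
  have hS2 : ∀ s ∈ S, (-n - 1 : ℝ) ≤ s := fun s hs => by
    by_contra! hlt
    refine M.one_notMem (M.solid' zero_le_one ?_ (hup hs hlt.le))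
    refine le_trans ?_ le_sup_left
    rw [map_sub, map_neg, map_one]
    have := (neg_le_abs a).trans hn'
    rw [neg_le_iff_add_nonneg'] at this
    rw [← sub_nonneg]
    convert this using 1
    ring
  set r := sInf S with hr
  refine ⟨r, ?_⟩
  by_contra hx
  obtain ⟨m, hm, hm0, k, hk⟩ := M.exists_one_le hx
  set ε : ℝ := 1 / (2 * (k + 1)) with hε
  have hεpos : 0 < ε := by positivity
  have h1 : r + ε ∈ S := by
    obtain ⟨s, hs, hlt⟩ := exists_lt_of_csInf_lt ⟨_, hS1⟩ (lt_add_of_pos_right r hεpos)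
    exact hup hs hlt.le
  have h2 : (algebraMap ℝ A (r - ε) - a) ⊔ 0 ∈ M := by
    refine (hor _).resolve_left fun h => ?_
    have := csInf_le ⟨_, hS2⟩ h
    linarith
  set p := (a - algebraMap ℝ A (r + ε)) ⊔ 0
  set q := (algebraMap ℝ A (r - ε) - a) ⊔ 0
  have hp0 : 0 ≤ p := le_sup_right
  have hq0 : 0 ≤ q := le_sup_right
  have hp : a - algebraMap ℝ A (r + ε) ≤ p := le_sup_left
  have hq : algebraMap ℝ A (r - ε) - a ≤ q := le_sup_left
  rw [map_add] at hp
  rw [map_sub] at hq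
  have habs : |a - algebraMap ℝ A r| ≤ algebraMap ℝ A ε + (p + q) := by
    refine sup_le ?_ ?_
    · rw [← sub_nonneg] at hp ⊢
      convert add_nonneg hp hq0 using 1
      ring
    · rw [← sub_nonneg] at hq ⊢
      convert add_nonneg hq hp0 using 1
      ring
  have h3 : (1 : A) ≤ (m + k • (p + q)) + algebraMap ℝ A (k * ε) := by
    refine (hk.trans (add_le_add_right (nsmul_le_nsmul_right habs k) m)).trans_eq ?_
    rw [smul_add, map_mul, map_natCast, nsmul_eq_mul, nsmul_eq_mul]
    ring
  have h4 : algebraMap ℝ A (1 - k * ε) ≤ m + k • (p + q) := by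
    rw [map_sub, map_one]
    exact sub_le_iff_le_add.2 h3
  have hpos : 0 < 1 - k * ε := by
    have : k * ε = k / (2 * (k + 1)) := by rw [hε]; ring
    rw [this, sub_pos, div_lt_one (by positivity)]
    linarith
  refine hreal hpos (M.solid' ?_ h4 (M.1.add_mem hm (nsmul_mem (M.1.add_mem h1 h2) _)))
  simpa using algebraMap_mono (A := A) hpos.le

theorem real_unique {a : A} {r s : ℝ} (hr : a - algebraMap ℝ A r ∈ M)
    (hs : a - algebraMap ℝ A s ∈ M) : r = s := by
  by_contra hne
  refine M.one_notMem ?_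
  have := M.1.mul_mem_left (algebraMap ℝ A (s - r)⁻¹) (M.1.sub_mem hr hs)
  rwa [sub_sub_sub_cancel_left, ← map_sub, ← map_mul,
    inv_mul_cancel₀ (sub_ne_zero.2 (Ne.symm hne)), map_one] at this

/-- `ev M a` is the unique real number `r` with `a + M = r + M`. -/
noncomputable def ev (a : A) : ℝ := (M.exists_real a).choose

theorem sub_ev_mem (a : A) : a - algebraMap ℝ A (M.ev a) ∈ M := (M.exists_real a).choose_spec

theorem ev_eq {a : A} {r : ℝ} (h : a - algebraMap ℝ A r ∈ M) : M.ev a = r :=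
  M.real_unique (M.sub_ev_mem a) h

theorem ev_eq_zero {a : A} : M.ev a = 0 ↔ a ∈ M :=
  ⟨fun h => by simpa [h] using M.sub_ev_mem a, fun h => M.ev_eq (by simpa using h)⟩

theorem ev_algebraMap (r : ℝ) : M.ev (algebraMap ℝ A r) = r := M.ev_eq (by
  rw [sub_self]; exact M.1.zero_mem)

theorem ev_add (a b : A) : M.ev (a + b) = M.ev a + M.ev b := M.ev_eq (by
  rw [map_add, add_sub_add_comm]; exact M.1.add_mem (M.sub_ev_mem a) (M.sub_ev_mem b))

theorem ev_mul (a b : A) : M.ev (a * b) = M.ev a * M.ev b := M.ev_eq (by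
  have h1 := M.1.mul_mem_right b (M.sub_ev_mem a)
  have h2 := M.1.mul_mem_left (algebraMap ℝ A (M.ev a)) (M.sub_ev_mem b)
  have := M.1.add_mem h1 h2
  rw [map_mul]
  change _ ∈ M.1
  convert this using 1
  ring)

theorem ev_neg (a : A) : M.ev (-a) = - M.ev a := by
  have h := M.ev_add a (-a)
  have h0 : M.ev (0 : A) = 0 := M.ev_eq_zero.2 M.1.zero_mem
  rw [add_neg_cancel, h0] at h
  linarith

theorem ev_sub (a b : A) : M.ev (a - b) = M.ev a - M.ev b := by
  rw [sub_eq_add_neg, ev_add, ev_neg, sub_eq_add_neg]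

theorem ev_nonneg {a : A} (h : 0 ≤ a) : 0 ≤ M.ev a := by
  by_contra! hlt
  have h1 : algebraMap ℝ A (- M.ev a) ≤ a - algebraMap ℝ A (M.ev a) := by
    rw [map_neg, sub_eq_add_neg]; exact le_add_of_nonneg_left h
  have h2 := M.solid' (by simpa using algebraMap_mono (A := A) (neg_pos.2 hlt).le) h1
    (M.sub_ev_mem a)
  have := M.ev_eq_zero.2 h2
  rw [ev_algebraMap] at this
  linarith

theorem ev_mono {a b : A} (h : a ≤ b) : M.ev a ≤ M.ev b := by
  have := M.ev_nonneg (sub_nonneg.2 h)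
  rw [ev_sub] at this
  linarith

theorem ev_posPart (a : A) : M.ev (a ⊔ 0) = M.ev a ⊔ 0 := by
  have h := sup_inf_sup_zero a
  have h1 : a ⊔ 0 - (-a ⊔ 0) = a := by
    have := posPart_sub_negPart a
    rwa [posPart_def, negPart_def] at this
  have h2 := M.ev_nonneg (le_sup_right : 0 ≤ a ⊔ 0)
  have h3 := M.ev_nonneg (le_sup_right : 0 ≤ -a ⊔ 0)
  have h4 := congrArg M.ev h1
  rw [ev_sub] at h4
  rcases M.mem_or_mem_of_inf h with h5 | h5 <;> rw [← ev_eq_zero] at h5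
  · rw [h5] at h4 ⊢; exact (max_eq_right (by linarith)).symm
  · rw [h5] at h4; rw [max_eq_left (a := M.ev a)] <;> linarith

theorem ev_sup (a b : A) : M.ev (a ⊔ b) = M.ev a ⊔ M.ev b := by
  have h : a ⊔ b = (a - b) ⊔ 0 + b := by rw [sup_add, sub_add_cancel, zero_add]
  rw [h, ev_add, ev_posPart, ev_sub, ← max_add_add_right, sub_add_cancel, zero_add]

theorem ev_inf (a b : A) : M.ev (a ⊓ b) = M.ev a ⊓ M.ev b := by
  have h : a ⊓ b = -(-a ⊔ -b) := by rw [neg_sup, neg_neg, neg_neg]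
  rw [h, ev_neg, ev_sup, ev_neg, ev_neg, neg_sup, neg_neg, neg_neg]

theorem ev_abs (a : A) : M.ev |a| = |M.ev a| := by rw [abs, ev_sup, ev_neg, abs]

/-- Evaluation at a maximal `ℓ`-ideal, as a morphism of algebras. -/
noncomputable def evHom : A →ₐ[ℝ] ℝ where
  toFun := M.ev
  map_one' := by simpa using M.ev_algebraMap 1
  map_mul' := M.ev_mul
  map_zero' := by simpa using M.ev_algebraMap 0
  map_add' := M.ev_add
  commutes' := M.ev_algebraMap

end Yosida

/-- The maximal `ℓ`-ideals detect the order. -/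
theorem le_of_ev {a b : A} (h : ∀ M : Yosida A, M.ev a ≤ M.ev b) : a ≤ b := by
  rw [← sub_nonpos]
  refine IsBal.archimedean _ 1 fun n => ?_
  by_contra hna
  set c := n • (a - b) - 1 with hc
  set d := (-c) ⊔ 0
  have hd0 : 0 ≤ d := le_sup_right
  have hbot : IsLIdeal (⊥ : Ideal A) := fun x y hxy hy => by
    rw [Ideal.mem_bot] at hy ⊢
    rw [hy, abs_zero] at hxy
    exact le_antisymm ((le_abs_self x).trans hxy)
      (neg_nonpos.1 ((neg_le_abs x).trans hxy))
  obtain ⟨M, hM⟩ := exists_yosida (adjoin_isLIdeal ⊥ d) (by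
    rintro ⟨m, hm, -, k, hk⟩
    rw [Ideal.mem_bot] at hm
    rw [hm, zero_add, abs_of_nonneg zero_le_one, abs_of_nonneg hd0] at hk
    have h1 := mul_le_mul_of_nonneg_right hk (le_sup_right : 0 ≤ c ⊔ 0)
    rw [one_mul, smul_mul_assoc, mul_comm, mul_eq_zero_of_inf (Yosida.sup_inf_sup_zero c),
      smul_zero] at h1
    exact hna (sub_nonpos.1 (le_sup_left.trans h1)))
  have h1 : M.ev d = 0 := M.ev_eq_zero.2 (hM (mem_adjoin _ _))
  have h2 : M.ev (-c) ≤ 0 := h1 ▸ M.ev_mono le_sup_left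
  have h3 : M.ev c = n * (M.ev a - M.ev b) - 1 := by
    rw [hc]
    change M.evHom _ = n * (M.evHom a - M.evHom b) - 1
    rw [map_sub, map_nsmul, map_sub, map_one, nsmul_eq_mul]
  rw [M.ev_neg, h3] at h2
  have h4 : (n : ℝ) * (M.ev a - M.ev b) ≤ 0 :=
    mul_nonpos_of_nonneg_of_nonpos n.cast_nonneg (sub_nonpos.2 (h M))
  linarith

theorem eq_of_ev {a b : A} (h : ∀ M : Yosida A, M.ev a = M.ev b) : a = b :=
  le_antisymm (le_of_ev fun M => (h M).le) (le_of_ev fun M => (h M).ge)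

end Yosida

section YosidaTopology

variable {A : Type u} [CommRing A] [Algebra ℝ A] [Lattice A] [IsBal A]

/-- `Z_ℓ(I)`, the set of maximal `ℓ`-ideals containing `I`. -/
def zeroLocus (I : Ideal A) : Set (Yosida A) := {M | I ≤ M.1}

/-- The closed sets of the Yosida space are exactly the sets `Z_ℓ(I)` for `I` an `ℓ`-ideal. -/
instance : TopologicalSpace (Yosida A) :=
  TopologicalSpace.ofClosed {Z | ∃ I : Ideal A, IsLIdeal I ∧ Z = zeroLocus I}
    ⟨⊤, fun _ _ _ _ => Submodule.mem_top, by
      refine (Set.eq_empty_of_forall_notMem fun M hM => ?_).symm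
      exact M.2.1.2 (top_le_iff.1 hM)⟩
    (by
      intro T hT
      refine ⟨sInf {K | IsLIdeal K ∧ ∀ I : Ideal A, zeroLocus I ∈ T → IsLIdeal I → I ≤ K}, ?_, ?_⟩
      · intro a b hab hb
        rw [Submodule.mem_sInf] at hb ⊢
        exact fun K hK => hK.1 a b hab (hb K hK)
      · ext M
        constructor
        · intro hM
          have h : M.1 ∈ {K | IsLIdeal K ∧ ∀ I : Ideal A, zeroLocus I ∈ T → IsLIdeal I → I ≤ K} :=
            ⟨M.2.1.1, fun I hI _ => hM _ hI⟩
          exact sInf_le h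
        · intro hM Z hZ
          obtain ⟨I, hI, rfl⟩ := hT hZ
          exact le_trans (b := sInf {K | IsLIdeal K ∧
            ∀ I : Ideal A, zeroLocus I ∈ T → IsLIdeal I → I ≤ K}) (le_sInf fun K hK => hK.2 I hZ hI) hM)
    (by
      rintro _ ⟨I, hI, rfl⟩ _ ⟨J, hJ, rfl⟩
      refine ⟨I ⊓ J, fun a b hab hb => ⟨hI a b hab hb.1, hJ a b hab hb.2⟩, ?_⟩
      ext M
      constructor
      · rintro (h | h)
        · exact le_trans (inf_le_left : I ⊓ J ≤ I) h
        · exact le_trans (inf_le_right : I ⊓ J ≤ J) h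
      · intro h
        by_contra hM
        obtain ⟨h1, h2⟩ := not_or.1 hM
        obtain ⟨a, ha, haM⟩ := Set.not_subset.1 h1
        obtain ⟨b, hb, hbM⟩ := Set.not_subset.1 h2
        have := h (⟨I.mul_mem_right b ha, J.mul_mem_left a hb⟩ : a * b ∈ I ⊓ J)
        have h3 := M.ev_eq_zero.2 this
        rw [M.ev_mul, mul_eq_zero, M.ev_eq_zero, M.ev_eq_zero] at h3
        exact h3.elim haM hbM)

theorem isClosed_iff_zeroLocus {Z : Set (Yosida A)} :
    IsClosed Z ↔ ∃ I : Ideal A, IsLIdeal I ∧ Z = zeroLocus I := by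
  rw [← isOpen_compl_iff]
  change (∃ I : Ideal A, IsLIdeal I ∧ Zᶜᶜ = zeroLocus I) ↔ _
  rw [compl_compl]

theorem isLIdeal_bot : IsLIdeal (⊥ : Ideal A) := fun x y hxy hy => by
  rw [Ideal.mem_bot] at hy ⊢
  rw [hy, abs_zero] at hxy
  exact le_antisymm ((le_abs_self x).trans hxy) (neg_nonpos.1 ((neg_le_abs x).trans hxy))

namespace Yosida

theorem isClosed_mem (a : A) : IsClosed {M : Yosida A | a ∈ M} := by
  rw [isClosed_iff_zeroLocus]
  refine ⟨adjoin ⊥ a, adjoin_isLIdeal _ _, Set.ext fun M => ⟨?_, fun h => h (mem_adjoin _ _)⟩⟩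
  rintro ha y ⟨m, hm, -, k, hk⟩
  rw [Ideal.mem_bot] at hm
  rw [hm, zero_add] at hk
  exact M.abs_mem.1 (M.solid' (abs_nonneg _) hk (nsmul_mem (M.abs_mem.2 ha) _))

theorem isClosed_ev_le (a : A) (r : ℝ) : IsClosed {M : Yosida A | M.ev a ≤ r} := by
  convert isClosed_mem ((a - algebraMap ℝ A r) ⊔ 0) using 1
  ext M
  rw [Set.mem_ofPred_eq, Set.mem_ofPred_eq, ← ev_eq_zero, ev_posPart, ev_sub, ev_algebraMap,
    sup_eq_right, sub_nonpos]

theorem continuous_ev (a : A) : Continuous fun M : Yosida A => M.ev a := by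
  rw [continuous_iff_lower_upperSemicontinuous, lowerSemicontinuous_iff_isClosed_preimage,
    upperSemicontinuous_iff_isClosed_preimage]
  refine ⟨fun r => isClosed_ev_le a r, fun r => ?_⟩
  convert isClosed_ev_le (-a) (-r) using 1
  ext M
  simp [ev_neg]

/-- The kernel of a unital `ℓ`-algebra morphism to `ℝ` is a maximal `ℓ`-ideal. -/
def ofHom (φ : A →ₐ[ℝ] ℝ) (h : ∀ a b, φ (a ⊔ b) = φ a ⊔ φ b) : Yosida A :=
  ⟨RingHom.ker φ, by
    have mono : ∀ {a b}, a ≤ b → φ a ≤ φ b := fun hab => by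
      rw [← sup_eq_right, ← h, sup_eq_right.2 hab]
    have habs : ∀ a, φ |a| = |φ a| := fun a => by rw [abs, h, map_neg, abs]
    refine ⟨⟨fun a b hab hb => ?_, ?_⟩, fun J hJ hle x hx => ?_⟩
    · have := mono hab
      rw [habs, habs, (RingHom.mem_ker).1 hb, abs_zero] at this
      exact abs_nonpos_iff.1 this
    · exact RingHom.ker_ne_top φ
    · by_contra hne
      have hne : φ x ≠ 0 := hne
      have h1 : x - algebraMap ℝ A (φ x) ∈ J := hle (by
        simp [RingHom.mem_ker])
      have h2 : algebraMap ℝ A (φ x) ∈ J := by simpa using J.sub_mem hx h1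
      refine hJ.2 ((Ideal.eq_top_iff_one _).2 ?_)
      have := J.mul_mem_left (algebraMap ℝ A (φ x)⁻¹) h2
      rwa [← map_mul, inv_mul_cancel₀ hne, map_one] at this⟩

theorem mem_ofHom {φ : A →ₐ[ℝ] ℝ} {h : ∀ a b, φ (a ⊔ b) = φ a ⊔ φ b} {a : A} :
    a ∈ ofHom φ h ↔ φ a = 0 := Iff.rfl

theorem ev_ofHom (φ : A →ₐ[ℝ] ℝ) (h : ∀ a b, φ (a ⊔ b) = φ a ⊔ φ b) (a : A) :
    (ofHom φ h).ev a = φ a := ev_eq _ (mem_ofHom.2 (by simp))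

theorem ext_ev {M N : Yosida A} (h : ∀ a, M.ev a = N.ev a) : M = N :=
  Yosida.ext fun a => by rw [← ev_eq_zero, h, ev_eq_zero]

instance : T2Space (Yosida A) :=
  T2Space.of_injective_continuous (f := fun (M : Yosida A) (a : A) => M.ev a)
    (fun _ _ h => ext_ev fun a => congrFun h a) (continuous_pi continuous_ev)

instance : CompactSpace (Yosida A) := by
  choose n hn using fun a : A => IsBal.bounded |a|
  let S : Set (A → ℝ) := (Set.univ.pi fun a => Set.Icc (-(n a : ℝ)) (n a)) ∩
    ({φ | ∀ r : ℝ, φ (algebraMap ℝ A r) = r} ∩ {φ | ∀ a b, φ (a + b) = φ a + φ b} ∩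
      {φ | ∀ a b, φ (a * b) = φ a * φ b} ∩ {φ | ∀ a b, φ (a ⊔ b) = φ a ⊔ φ b})
  have hS : IsCompact S := by
    refine (isCompact_univ_pi fun a => isCompact_Icc).inter_right ?_
    simp only [Set.ofPred_forall]
    refine (((isClosed_iInter fun r => ?_).inter (isClosed_iInter fun a => isClosed_iInter fun b =>
      ?_)).inter (isClosed_iInter fun a => isClosed_iInter fun b => ?_)).inter
      (isClosed_iInter fun a => isClosed_iInter fun b => ?_) <;>
    exact isClosed_eq (by fun_prop) (by fun_prop)
  have : CompactSpace S := isCompact_iff_compactSpace.1 hS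
  let F : S → Yosida A := fun φ => ofHom
    { toFun := φ.1
      map_one' := by simpa using φ.2.2.1.1.1 1
      map_zero' := by simpa using φ.2.2.1.1.1 0
      map_add' := φ.2.2.1.1.2
      map_mul' := φ.2.2.1.2
      commutes' := φ.2.2.1.1.1 } φ.2.2.2
  have hF : Continuous F := by
    refine continuous_iff_isClosed.2 fun Z hZ => ?_
    obtain ⟨I, -, rfl⟩ := isClosed_iff_zeroLocus.1 hZ
    have : F ⁻¹' zeroLocus I = ⋂ a ∈ I, {φ : S | φ.1 a = 0} := by
      ext φ
      simp only [Set.mem_iInter]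
      rfl
    rw [this]
    exact isClosed_biInter fun a _ => isClosed_eq ((continuous_apply a).comp continuous_subtype_val)
      continuous_const
  have hsurj : Function.Surjective F := fun M => by
    refine ⟨⟨M.ev, ⟨fun a _ => ?_, ⟨⟨M.ev_algebraMap, M.ev_add⟩, M.ev_mul⟩, M.ev_sup⟩⟩,
      ext_ev fun a => ev_ofHom _ _ _⟩
    have := M.ev_mono (hn a)
    rw [M.ev_abs, ← Nat.cast_smul_eq_nsmul ℝ, ← Algebra.algebraMap_eq_smul_one,
      M.ev_algebraMap] at this
    exact abs_le.1 this
  exact hsurj.compactSpace hF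

end Yosida

end YosidaTopology

/-! ### The functors of Gelfand duality -/

/-- The Yosida space of `A`, as a compact Hausdorff space. -/
def yosida (A : BAL.{u}) : CompHaus.{u} := CompHaus.of (Yosida A)

/-- The inverse image of a maximal `ℓ`-ideal. -/
def Yosida.comap {A B : BAL.{u}} (f : A ⟶ B) (M : Yosida B) : Yosida A :=
  ⟨M.1.comap f.hom, by
    convert (Yosida.ofHom (M.evHom.comp f.hom) fun a b => ?_).2 using 1
    · ext a
      exact M.ev_eq_zero.symm
    · exact (congrArg M.ev (f.map_sup a b)).trans (M.ev_sup _ _)⟩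

theorem Yosida.ev_comap {A B : BAL.{u}} (f : A ⟶ B) (M : Yosida B) (a : A) :
    (M.comap f).ev a = M.ev (f.hom a) :=
  Yosida.ev_eq _ (by
    change f.hom _ ∈ M
    rw [map_sub, AlgHom.commutes]
    exact M.sub_ev_mem _)

/-- The continuous map `Y(f) = f⁻¹ : Y_B → Y_A`. -/
def yosidaMap {A B : BAL.{u}} (f : A ⟶ B) : yosida B ⟶ yosida A :=
  CompHausLike.ofHom _ ⟨Yosida.comap f, by
    refine continuous_iff_isClosed.2 fun Z hZ => ?_
    obtain ⟨I, -, rfl⟩ := isClosed_iff_zeroLocus.1 hZ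
    have : Yosida.comap f ⁻¹' zeroLocus I = ⋂ a ∈ I, {M : Yosida B | f.hom a ∈ M} := by
      ext M
      simp only [Set.mem_iInter]
      rfl
    rw [this]
    exact isClosed_biInter fun a _ => Yosida.isClosed_mem _⟩

instance {X : Type u} [TopologicalSpace X] [CompactSpace X] : IsBal C(X, ℝ) where
  add_le_add a b c h := fun x => by simpa using h x
  mul_nonneg a b ha hb := fun x => mul_nonneg (ha x) (hb x)
  smul_nonneg r a hr ha := fun x => mul_nonneg hr (ha x)
  bounded a := by
    obtain ⟨n, hn⟩ := exists_nat_ge ‖a‖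
    refine ⟨n, fun x => ?_⟩
    simpa using (le_abs_self _).trans ((a.norm_coe_le_norm x).trans hn)
  archimedean a b h := fun x => by
    by_contra hx
    replace hx : 0 < a x := not_le.1 hx
    obtain ⟨n, hn⟩ := Archimedean.arch (b x + 1) hx
    have : n • a x ≤ b x := h n x
    linarith

/-- The algebra `C(X)` of continuous real-valued functions with pointwise structure. -/
def contAlg (X : CompHaus.{u}) : BAL.{u} := ⟨C(X, ℝ)⟩

/-- `C(φ)(f) = f ∘ φ`. -/
def contMap {X Y : CompHaus.{u}} (φ : X ⟶ Y) : contAlg Y ⟶ contAlg X where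
  hom := ContinuousMap.compRightAlgHom ℝ ℝ φ.hom.hom
  map_sup _ _ := rfl
  map_inf _ _ := rfl

/-- `ζ_A(a)(M)` is the unique real number `r` with `a + M = r + M`. -/
noncomputable def zeta (A : BAL.{u}) : A ⟶ contAlg (yosida A) where
  hom :=
    { toFun := fun a => (⟨fun M : Yosida A => M.ev a, Yosida.continuous_ev a⟩ : C(Yosida A, ℝ))
      map_one' := ContinuousMap.ext fun M => map_one (Yosida.evHom M)
      map_mul' := fun a b => ContinuousMap.ext fun M => Yosida.ev_mul M a b
      map_zero' := ContinuousMap.ext fun M => map_zero (Yosida.evHom M)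
      map_add' := fun a b => ContinuousMap.ext fun M => Yosida.ev_add M a b
      commutes' := fun r => ContinuousMap.ext fun M => Yosida.ev_algebraMap M r }
  map_sup a b := ContinuousMap.ext fun M => Yosida.ev_sup M a b
  map_inf a b := ContinuousMap.ext fun M => Yosida.ev_inf M a b

/-- The maximal `ℓ`-ideal `{f ∈ C(X) | f(x) = 0}`. -/
def pointIdeal {X : CompHaus.{u}} (x : X) : Yosida (contAlg X) :=
  Yosida.ofHom (A := C(X, ℝ)) (ContinuousMap.evalAlgHom ℝ ℝ x) fun _ _ => rfl

theorem mem_pointIdeal {X : CompHaus.{u}} {x : X} {f : C(X, ℝ)} :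
    (f : contAlg X) ∈ pointIdeal x ↔ f x = 0 := Iff.rfl

/-- `ε_X : X → Y_{C(X)}`, `ε_X(x) = {f ∈ C(X) | f(x) = 0}`. -/
def epsilon (X : CompHaus.{u}) : X ⟶ yosida (contAlg X) :=
  CompHausLike.ofHom _ ⟨pointIdeal, by
    refine continuous_iff_isClosed.2 fun Z hZ => ?_
    obtain ⟨I, -, rfl⟩ := isClosed_iff_zeroLocus.1 hZ
    have : pointIdeal ⁻¹' zeroLocus I = ⋂ (f : C(X, ℝ)) (_ : f ∈ I), {x : X | f x = 0} := by
      ext x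
      simp only [Set.mem_iInter]
      rfl
    rw [this]
    exact isClosed_biInter fun f _ => isClosed_eq f.continuous continuous_const⟩

theorem exists_separating {X : Type u} [TopologicalSpace X] [CompactSpace X] [T2Space X]
    {C : Set X} (hC : IsClosed C) {x : X} (hx : x ∉ C) :
    ∃ f : C(X, ℝ), f x = 0 ∧ ∀ y ∈ C, f y = 1 := by
  obtain ⟨f, hf0, hf1, -⟩ := exists_continuous_zero_one_of_isClosed (isClosed_singleton (x := x))
    hC (Set.disjoint_singleton_left.2 hx)
  exact ⟨f, hf0 rfl, fun y hy => hf1 hy⟩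

instance (X : CompHaus.{u}) : IsIso (epsilon X) := by
  refine CompHausLike.isIso_of_bijective _ ⟨fun x y hxy => ?_, fun M => ?_⟩
  · by_contra hne
    have : T1Space X.toTop := @T2Space.t1Space _ _ X.is_hausdorff
    obtain ⟨f, hf0, hf1⟩ := exists_separating (X := X.toTop) (C := {y}) (x := x)
      isClosed_singleton hne
    have h1 : (f : contAlg X) ∈ pointIdeal x := mem_pointIdeal.2 hf0
    have h2 : pointIdeal x = pointIdeal y := hxy
    rw [h2, mem_pointIdeal, hf1 y rfl] at h1
    exact one_ne_zero h1
  · change Yosida C(X, ℝ) at M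
    suffices h : ∃ x : X, ∀ f : C(X, ℝ), f ∈ M → f x = 0 by
      obtain ⟨x, hx⟩ := h
      refine ⟨x, Subtype.ext ?_⟩
      exact le_antisymm (M.2.2 (pointIdeal x).2.1 hx) hx
    by_contra! h
    choose f hfM hf using h
    obtain ⟨t, ht⟩ := isCompact_univ.elim_finite_subcover (fun x => {y : X | f x y ≠ 0})
      (fun x => isOpen_ne_fun (f x).continuous continuous_const)
      (fun x _ => Set.mem_iUnion.2 ⟨x, hf x⟩)
    set g : C(X, ℝ) := ∑ x ∈ t, f x * f x with hg
    have hgM : g ∈ M := M.1.sum_mem fun x _ => M.1.mul_mem_left _ (hfM x)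
    have hpos : ∀ y, g y ≠ 0 := fun y => by
      obtain ⟨x, hx, hxy⟩ := Set.mem_iUnion₂.1 (ht (Set.mem_univ y))
      rw [hg, ContinuousMap.sum_apply]
      refine (Finset.sum_pos' (fun z _ => mul_self_nonneg _) ⟨x, hx, ?_⟩).ne'
      exact mul_self_pos.2 hxy
    refine M.one_notMem ?_
    have := M.1.mul_mem_left (⟨fun y => (g y)⁻¹, g.continuous.inv₀ hpos⟩ : C(X, ℝ)) hgM
    change _ ∈ M.1
    convert this using 1
    ext y
    exact (inv_mul_cancel₀ (hpos y)).symm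

/-! ### Free objects over weighted sets -/

section Norm

variable {A : Type u} [CommRing A] [Algebra ℝ A] [Lattice A] [IsBal A]

theorem abs_ev_le_balNorm (M : Yosida A) (a : A) : |M.ev a| ≤ balNorm a := by
  obtain ⟨n, hn⟩ := IsBal.bounded |a|
  refine le_csInf ⟨(n : ℝ), by simpa [Nat.cast_smul_eq_nsmul] using hn⟩ fun r hr => ?_
  have := M.ev_mono hr
  rwa [M.ev_abs, ← Algebra.algebraMap_eq_smul_one, M.ev_algebraMap] at this

theorem balNorm_le {a : A} {c : ℝ} (hc : 0 ≤ c) (h : ∀ M : Yosida A, |M.ev a| ≤ c) :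
    balNorm a ≤ c := by
  rcases isEmpty_or_nonempty (Yosida A) with hA | ⟨⟨M⟩⟩
  · have : {r : ℝ | |a| ≤ r • (1 : A)} = Set.univ :=
      Set.eq_univ_of_forall fun r => le_of_ev fun M => hA.elim M
    rw [balNorm, this, Real.sInf_univ]
    exact hc
  · refine csInf_le ⟨0, fun r hr => ?_⟩ (le_of_ev fun M => ?_)
    · have := M.ev_mono hr
      rw [M.ev_abs, ← Algebra.algebraMap_eq_smul_one, M.ev_algebraMap] at this
      exact (abs_nonneg _).trans this
    · rw [M.ev_abs, ← Algebra.algebraMap_eq_smul_one, M.ev_algebraMap]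
      exact h M

end Norm

section Free

variable {X : Type u} (w : X → ℝ)

/-- The box `∏ₓ [-w(x), w(x)]`. -/
def Box : Type u := {t : X → ℝ // ∀ x, |t x| ≤ w x}

/-- The algebra of functions on the box generated, under the algebra and lattice operations, by the
coordinate projections. -/
def freeSubalgebra : Subalgebra ℝ (Box w → ℝ) :=
  sInf {S | (∀ f ∈ S, ∀ g ∈ S, f ⊔ g ∈ S) ∧ (∀ f ∈ S, ∀ g ∈ S, f ⊓ g ∈ S) ∧
    ∀ x : X, (fun t : Box w => t.1 x) ∈ S}

variable {w}

theorem free_induction {P : (Box w → ℝ) → Prop} (proj : ∀ x, P fun t => t.1 x)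
    (real : ∀ r, P (algebraMap ℝ _ r)) (add : ∀ f g, P f → P g → P (f + g))
    (mul : ∀ f g, P f → P g → P (f * g)) (sup : ∀ f g, P f → P g → P (f ⊔ g))
    (inf : ∀ f g, P f → P g → P (f ⊓ g)) : ∀ f ∈ freeSubalgebra w, P f := by
  intro f hf
  let S : Subalgebra ℝ (Box w → ℝ) :=
    { carrier := {f | P f}
      mul_mem' := mul _ _
      add_mem' := add _ _
      algebraMap_mem' := real }
  exact (Algebra.mem_sInf.1 hf) S ⟨fun f hf g hg => sup f g hf hg, fun f hf g hg => inf f g hf hg,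
    proj⟩

theorem proj_mem (x : X) : (fun t : Box w => t.1 x) ∈ freeSubalgebra w :=
  Algebra.mem_sInf.2 fun _ hS => hS.2.2 x

instance : Lattice (freeSubalgebra w) :=
  Subtype.lattice
    (fun _ _ hf hg => Algebra.mem_sInf.2 fun S hS =>
      hS.1 _ (Algebra.mem_sInf.1 hf S hS) _ (Algebra.mem_sInf.1 hg S hS))
    (fun _ _ hf hg => Algebra.mem_sInf.2 fun S hS =>
      hS.2.1 _ (Algebra.mem_sInf.1 hf S hS) _ (Algebra.mem_sInf.1 hg S hS))

theorem free_bounded : ∀ f ∈ freeSubalgebra w, ∃ n : ℕ, ∀ t, |f t| ≤ n := by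
  refine free_induction (fun x => ?_) (fun r => ?_) ?_ ?_ ?_ ?_
  · obtain ⟨n, hn⟩ := exists_nat_ge (w x)
    exact ⟨n, fun t => (t.2 x).trans hn⟩
  · obtain ⟨n, hn⟩ := exists_nat_ge |r|
    exact ⟨n, fun t => hn⟩
  all_goals
    rintro f g ⟨n, hn⟩ ⟨m, hm⟩
  · exact ⟨n + m, fun t => (abs_add_le _ _).trans (by push_cast; exact _root_.add_le_add (hn t) (hm t))⟩
  · refine ⟨n * m, fun t => ?_⟩
    rw [Pi.mul_apply, abs_mul, Nat.cast_mul]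
    exact mul_le_mul (hn t) (hm t) (abs_nonneg _) (Nat.cast_nonneg _)
  · refine ⟨n + m, fun t => (abs_max_le_max_abs_abs).trans (max_le ?_ ?_)⟩ <;> push_cast
    · exact (hn t).trans (by simp)
    · exact (hm t).trans (by simp)
  · refine ⟨n + m, fun t => (abs_min_le_max_abs_abs).trans (max_le ?_ ?_)⟩ <;> push_cast
    · exact (hn t).trans (by simp)
    · exact (hm t).trans (by simp)

instance : IsBal (freeSubalgebra w) where
  add_le_add a b c h := fun t => by simpa using h t
  mul_nonneg a b ha hb := fun t => mul_nonneg (ha t) (hb t)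
  smul_nonneg r a hr ha := fun t => mul_nonneg hr (ha t)
  bounded a := by
    obtain ⟨n, hn⟩ := free_bounded a.1 a.2
    exact ⟨n, fun t => by simpa using (le_abs_self _).trans (hn t)⟩
  archimedean a b h := fun t => by
    by_contra hx
    replace hx : 0 < a.1 t := not_le.1 hx
    obtain ⟨n, hn⟩ := Archimedean.arch (b.1 t + 1) hx
    have : n • a.1 t ≤ b.1 t := h n t
    linarith

variable (w) in
/-- The free object of `baℓ` over the weighted set `(X, w)`, where `w` is a nonnegative function. -/
def freeBal : BAL.{u} := ⟨freeSubalgebra w⟩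

variable (w) in
/-- The canonical map from a weighted set to its free object. -/
def freeGen (x : X) : freeBal w := (⟨_, proj_mem x⟩ : freeSubalgebra w)

theorem free_hom_ext {B : BAL.{u}} {f g : freeBal w ⟶ B}
    (h : ∀ x, f.hom (freeGen w x) = g.hom (freeGen w x)) : f = g := by
  ext ⟨a, ha⟩
  revert ha
  suffices H : ∀ a ∈ freeSubalgebra w, ∃ ha : a ∈ freeSubalgebra w,
      f.hom (⟨a, ha⟩ : freeSubalgebra w) = g.hom (⟨a, ha⟩ : freeSubalgebra w) from
    fun ha => (H a ha).2
  refine free_induction (fun x => ⟨proj_mem x, h x⟩)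
    (fun r => ⟨Subalgebra.algebraMap_mem _ r, (f.hom.commutes r).trans (g.hom.commutes r).symm⟩)
    ?_ ?_ ?_ ?_
  all_goals rintro a b ⟨ha, h1⟩ ⟨hb, h2⟩
  · refine ⟨add_mem ha hb, ?_⟩
    have := (f.hom.map_add (⟨a, ha⟩ : freeSubalgebra w) (⟨b, hb⟩ : freeSubalgebra w)).trans
      ((congrArg₂ (· + ·) h1 h2).trans (g.hom.map_add _ _).symm)
    exact this
  · refine ⟨mul_mem ha hb, ?_⟩
    have := (f.hom.map_mul (⟨a, ha⟩ : freeSubalgebra w) (⟨b, hb⟩ : freeSubalgebra w)).trans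
      ((congrArg₂ (· * ·) h1 h2).trans (g.hom.map_mul _ _).symm)
    exact this
  · exact ⟨((⟨a, ha⟩ : freeSubalgebra w) ⊔ ⟨b, hb⟩).2,
      (f.map_sup (⟨a, ha⟩ : freeSubalgebra w) (⟨b, hb⟩ : freeSubalgebra w)).trans
      ((congrArg₂ (· ⊔ ·) h1 h2).trans (g.map_sup _ _).symm)⟩
  · exact ⟨((⟨a, ha⟩ : freeSubalgebra w) ⊓ ⟨b, hb⟩).2,
      (f.map_inf (⟨a, ha⟩ : freeSubalgebra w) (⟨b, hb⟩ : freeSubalgebra w)).trans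
      ((congrArg₂ (· ⊓ ·) h1 h2).trans (g.map_inf _ _).symm)⟩

section Lift

variable {B : BAL.{u}} (g : X → B) (hg : ∀ x, balNorm (g x) ≤ w x)

theorem exists_lift {w : X → ℝ} {B : BAL.{u}} (g : X → B) (hg : ∀ x, balNorm (g x) ≤ w x) (f : freeBal w) : ∃ b : B, ∀ M : Yosida B,
    M.ev b = f.1 ⟨fun x => M.ev (g x), fun x => (abs_ev_le_balNorm M _).trans (hg x)⟩ := by
  revert f
  suffices H : ∀ f ∈ freeSubalgebra w, ∃ b : B, ∀ M : Yosida B,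
      M.ev b = f ⟨fun x => M.ev (g x), fun x => (abs_ev_le_balNorm M _).trans (hg x)⟩ from
    fun f => H f.1 f.2
  refine free_induction (fun x => ⟨g x, fun M => rfl⟩)
    (fun r => ⟨algebraMap ℝ B r, fun M => M.ev_algebraMap r⟩) ?_ ?_ ?_ ?_
  all_goals rintro f f' ⟨b, hb⟩ ⟨b', hb'⟩
  · exact ⟨b + b', fun M => by rw [M.ev_add, hb, hb']; rfl⟩
  · exact ⟨b * b', fun M => by rw [M.ev_mul, hb, hb']; rfl⟩
  · exact ⟨b ⊔ b', fun M => by rw [M.ev_sup, hb, hb']; rfl⟩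
  · exact ⟨b ⊓ b', fun M => by rw [M.ev_inf, hb, hb']; rfl⟩

/-- The universal property of the free object: a map `g` with `‖g(x)‖ ≤ w(x)` extends to a
morphism (uniquely, by `free_hom_ext`). -/
noncomputable def freeLift : freeBal w ⟶ B where
  hom :=
    { toFun := fun f => (exists_lift g hg f).choose
      map_one' := eq_of_ev fun M => by
        rw [(exists_lift g hg _).choose_spec M, ← map_one (algebraMap ℝ B), M.ev_algebraMap]; rfl
      map_mul' := fun f f' => eq_of_ev fun M => by
        rw [M.ev_mul, (exists_lift g hg _).choose_spec M, (exists_lift g hg _).choose_spec M,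
          (exists_lift g hg _).choose_spec M]; rfl
      map_zero' := eq_of_ev fun M => by
        rw [(exists_lift g hg _).choose_spec M, ← map_zero (algebraMap ℝ B), M.ev_algebraMap]; rfl
      map_add' := fun f f' => eq_of_ev fun M => by
        rw [M.ev_add, (exists_lift g hg _).choose_spec M, (exists_lift g hg _).choose_spec M,
          (exists_lift g hg _).choose_spec M]; rfl
      commutes' := fun r => eq_of_ev fun M => by
        rw [(exists_lift g hg _).choose_spec M, M.ev_algebraMap]; rfl }
  map_sup f f' := eq_of_ev fun M => by
    change M.ev (exists_lift g hg (f ⊔ f')).choose =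
      M.ev ((exists_lift g hg f).choose ⊔ (exists_lift g hg f').choose)
    rw [M.ev_sup, (exists_lift g hg _).choose_spec M, (exists_lift g hg _).choose_spec M,
      (exists_lift g hg _).choose_spec M]; rfl
  map_inf f f' := eq_of_ev fun M => by
    change M.ev (exists_lift g hg (f ⊓ f')).choose =
      M.ev ((exists_lift g hg f).choose ⊓ (exists_lift g hg f').choose)
    rw [M.ev_inf, (exists_lift g hg _).choose_spec M, (exists_lift g hg _).choose_spec M,
      (exists_lift g hg _).choose_spec M]; rfl

theorem freeLift_gen (x : X) : (freeLift g hg).hom (freeGen w x) = g x :=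
  eq_of_ev fun M => (exists_lift g hg (freeGen w x)).choose_spec M

end Lift

end Free

/-! ### Quotients by archimedean `ℓ`-ideals -/

section Quotient

variable {A : Type u} [CommRing A] [Algebra ℝ A] [Lattice A] [IsBal A]

theorem IsLIdeal.sup_sub_mem {I : Ideal A} (hI : IsLIdeal I) {a a' b b' : A} (ha : a - a' ∈ I)
    (hb : b - b' ∈ I) : a ⊔ b - a' ⊔ b' ∈ I := by
  have h1 : a ⊔ b - a' ⊔ b ∈ I := hI _ _ (abs_sup_sub_sup_le_abs a a' b) ha
  have h2 : a' ⊔ b - a' ⊔ b' ∈ I := by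
    rw [sup_comm a' b, sup_comm a' b']
    exact hI _ _ (abs_sup_sub_sup_le_abs b b' a') hb
  simpa using I.add_mem h1 h2

theorem IsLIdeal.inf_sub_mem {I : Ideal A} (hI : IsLIdeal I) {a a' b b' : A} (ha : a - a' ∈ I)
    (hb : b - b' ∈ I) : a ⊓ b - a' ⊓ b' ∈ I := by
  have h1 : a ⊓ b - a' ⊓ b ∈ I := hI _ _ (abs_inf_sub_inf_le_abs a a' b) ha
  have h2 : a' ⊓ b - a' ⊓ b' ∈ I := by
    rw [inf_comm a' b, inf_comm a' b']
    exact hI _ _ (abs_inf_sub_inf_le_abs b b' a') hb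
  simpa using I.add_mem h1 h2

/-- The quotient lattice structure on `A / I`, for `I` an `ℓ`-ideal. -/
@[reducible] def quotLattice {I : Ideal A} (hI : IsLIdeal I) : Lattice (A ⧸ I) :=
  let _ : Max (A ⧸ I) := ⟨fun x y => Quotient.liftOn₂' x y (fun a b => Ideal.Quotient.mk I (a ⊔ b))
    fun _ _ _ _ h1 h2 => Ideal.Quotient.eq.2 (hI.sup_sub_mem
      ((Submodule.quotientRel_def I).1 h1) ((Submodule.quotientRel_def I).1 h2))⟩
  let _ : Min (A ⧸ I) := ⟨fun x y => Quotient.liftOn₂' x y (fun a b => Ideal.Quotient.mk I (a ⊓ b))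
    fun _ _ _ _ h1 h2 => Ideal.Quotient.eq.2 (hI.inf_sub_mem
      ((Submodule.quotientRel_def I).1 h1) ((Submodule.quotientRel_def I).1 h2))⟩
  Lattice.mk'
    (by rintro ⟨a⟩ ⟨b⟩; exact congrArg (Ideal.Quotient.mk I) (sup_comm a b))
    (by rintro ⟨a⟩ ⟨b⟩ ⟨c⟩; exact congrArg (Ideal.Quotient.mk I) (sup_assoc a b c))
    (by rintro ⟨a⟩ ⟨b⟩; exact congrArg (Ideal.Quotient.mk I) (inf_comm a b))
    (by rintro ⟨a⟩ ⟨b⟩ ⟨c⟩; exact congrArg (Ideal.Quotient.mk I) (inf_assoc a b c))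
    (by rintro ⟨a⟩ ⟨b⟩; exact congrArg (Ideal.Quotient.mk I) sup_inf_self)
    (by rintro ⟨a⟩ ⟨b⟩; exact congrArg (Ideal.Quotient.mk I) inf_sup_self)

/-- An `ℓ`-ideal `I` is archimedean if `A / I` is archimedean. -/
structure IsArchLIdeal (I : Ideal A) : Prop where
  isLIdeal : IsLIdeal I
  arch : letI := quotLattice isLIdeal
    ∀ x y : A ⧸ I, (∀ n : ℕ, n • x ≤ y) → x ≤ 0

theorem quot_le_iff {I : Ideal A} (hI : IsLIdeal I) (a b : A) : letI := quotLattice hI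
    (Ideal.Quotient.mk I a ≤ Ideal.Quotient.mk I b ↔ a ⊔ b - b ∈ I) := by
  let _ := quotLattice hI
  rw [← sup_eq_right]
  exact Ideal.Quotient.eq

theorem isArchLIdeal_iff {I : Ideal A} : IsArchLIdeal I ↔ IsLIdeal I ∧
    ∀ a b : A, (∀ n : ℕ, (n • a) ⊔ b - b ∈ I) → a ⊔ 0 ∈ I := by
  constructor
  · intro h
    refine ⟨h.1, fun a b hab => ?_⟩
    have := (quot_le_iff h.1 a 0).1 (h.2 (Ideal.Quotient.mk I a) (Ideal.Quotient.mk I b) fun n => by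
      rw [← map_nsmul]
      exact (quot_le_iff h.1 _ _).2 (hab n))
    rwa [sub_zero] at this
  · intro h
    refine ⟨h.1, ?_⟩
    rintro ⟨a⟩ ⟨b⟩ hab
    refine (quot_le_iff h.1 a 0).2 ?_
    rw [sub_zero]
    refine h.2 a b fun n => (quot_le_iff h.1 _ _).1 ?_
    rw [map_nsmul]
    exact hab n

/-- The archimedean `ℓ`-ideal generated by a set. -/
def archSpan (S : Set A) : Ideal A := sInf {I | IsArchLIdeal I ∧ S ⊆ I}

theorem archSpan_le {S : Set A} {I : Ideal A} (hI : IsArchLIdeal I) (h : S ⊆ I) :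
    archSpan S ≤ I := sInf_le (show I ∈ {I | IsArchLIdeal I ∧ S ⊆ I} from ⟨hI, h⟩)

theorem subset_archSpan (S : Set A) : S ⊆ archSpan S := fun _ ha =>
  (Submodule.mem_sInf).2 fun _ hI => hI.2 ha

theorem isArchLIdeal_archSpan (S : Set A) : IsArchLIdeal (archSpan S) := by
  refine isArchLIdeal_iff.2 ⟨fun a b hab hb => ?_, fun a b hab => ?_⟩
  · exact Submodule.mem_sInf.2 fun I hI => hI.1.1 a b hab (Submodule.mem_sInf.1 hb I hI)
  · exact Submodule.mem_sInf.2 fun I hI => (isArchLIdeal_iff.1 hI.1).2 a b fun n =>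
      Submodule.mem_sInf.1 (hab n) I hI

theorem quot_isBal {I : Ideal A} (h : IsArchLIdeal I) :
    letI := quotLattice h.isLIdeal
    IsBal (A ⧸ I) := by
  let _ := quotLattice h.isLIdeal
  have key : ∀ x y : A ⧸ I, x ≤ y → ∃ a b : A, a ≤ b ∧ Ideal.Quotient.mk I a = x ∧
      Ideal.Quotient.mk I b = y := by
    rintro ⟨a⟩ ⟨b⟩ hab
    exact ⟨a, a ⊔ b, le_sup_left, rfl, sup_eq_right.2 hab⟩
  have key' : ∀ a b : A, a ≤ b → Ideal.Quotient.mk I a ≤ Ideal.Quotient.mk I b := fun a b hab => by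
    rw [quot_le_iff h.1, sup_eq_right.2 hab, sub_self]
    exact I.zero_mem
  have key0 : ∀ x : A ⧸ I, 0 ≤ x → ∃ a : A, 0 ≤ a ∧ Ideal.Quotient.mk I a = x := by
    rintro ⟨a⟩ ha
    exact ⟨0 ⊔ a, le_sup_left, sup_eq_right.2 ha⟩
  refine ⟨?_, ?_, ?_, ?_, h.arch⟩
  · rintro x y ⟨c⟩ hxy
    obtain ⟨a, b, hab, rfl, rfl⟩ := key x y hxy
    exact key' (a + c) (b + c) (_root_.add_le_add_left hab c)
  · intro x y hx hy
    obtain ⟨a, ha, rfl⟩ := key0 x hx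
    obtain ⟨b, hb, rfl⟩ := key0 y hy
    exact key' 0 (a * b) (mul_nonneg ha hb)
  · intro r x hr hx
    obtain ⟨a, ha, rfl⟩ := key0 x hx
    exact key' 0 (r • a) (IsBal.smul_nonneg r a hr ha)
  · rintro ⟨a⟩
    obtain ⟨n, hn⟩ := IsBal.bounded a
    exact ⟨n, key' a (n • 1) hn⟩

end Quotient

/-- The quotient of `A` by an archimedean `ℓ`-ideal, as an object of `baℓ`. -/
def quotBal (A : BAL.{u}) {I : Ideal A} (h : IsArchLIdeal I) : BAL.{u} :=
  letI := quotLattice h.isLIdeal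
  { carrier := A ⧸ I, isBal := quot_isBal h }

/-- The quotient morphism. -/
def quotMk (A : BAL.{u}) {I : Ideal A} (h : IsArchLIdeal I) : A ⟶ quotBal A h where
  hom := Ideal.Quotient.mkₐ ℝ I
  map_sup _ _ := rfl
  map_inf _ _ := rfl

theorem quotMk_surjective (A : BAL.{u}) {I : Ideal A} (h : IsArchLIdeal I) :
    Function.Surjective (quotMk A h).hom := Ideal.Quotient.mk_surjective

/-- A morphism vanishing on `I` factors through the quotient. -/
def quotLift {A B : BAL.{u}} {I : Ideal A} (h : IsArchLIdeal I) (f : A ⟶ B)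
    (hf : ∀ a ∈ I, f.hom a = 0) : quotBal A h ⟶ B where
  hom := Ideal.Quotient.liftₐ I f.hom hf
  map_sup := by rintro ⟨a⟩ ⟨b⟩; exact f.map_sup a b
  map_inf := by rintro ⟨a⟩ ⟨b⟩; exact f.map_inf a b

theorem quotLift_mk {A B : BAL.{u}} {I : Ideal A} (h : IsArchLIdeal I) (f : A ⟶ B)
    (hf : ∀ a ∈ I, f.hom a = 0) (a : A) : (quotLift h f hf).hom ((quotMk A h).hom a) = f.hom a :=
  rfl

theorem isArchLIdeal_ker {A B : BAL.{u}} (f : A ⟶ B) : IsArchLIdeal (RingHom.ker f.hom) := by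
  refine isArchLIdeal_iff.2 ⟨fun a b hab hb => ?_, fun a b hab => ?_⟩
  · have := f.mono hab
    rw [f.map_abs, f.map_abs, RingHom.mem_ker.1 hb] at this
    exact isLIdeal_bot _ _ this (Ideal.zero_mem _)
  · rw [RingHom.mem_ker, f.map_sup, map_zero, sup_eq_right]
    refine IsBal.archimedean _ (f.hom b) fun n => ?_
    have := RingHom.mem_ker.1 (hab n)
    rw [map_sub, f.map_sup, sub_eq_zero, sup_eq_right, map_nsmul] at this
    exact this

/-! ### Modal operators and the endofunctor `H` -/

/-- The identities satisfied by a modal operator, for a map between objects of `baℓ`. A modal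
operator on `A` is a map `A → A` satisfying them; real numbers `r` are identified with `r · 1`. -/
structure IsModalMap {A B : BAL.{u}} (g : A → B) : Prop where
  map_inf : ∀ a b : A, g (a ⊓ b) = g a ⊓ g b
  map_real : ∀ r : ℝ, g (algebraMap ℝ A r) = algebraMap ℝ B r + (1 - algebraMap ℝ B r) * g 0
  map_posPart : ∀ a : A, g (a ⊔ 0) = g a ⊔ 0
  map_add_real : ∀ (a : A) (r : ℝ), g (a + algebraMap ℝ A r) = g a + g (algebraMap ℝ A r) - g 0
  map_real_mul : ∀ (r : ℝ) (a : A), 0 ≤ r →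
    g (algebraMap ℝ A r * a) = g (algebraMap ℝ A r) * g a

/-- The weight `w_A(a) = max {‖a‖, 1}`. -/
noncomputable def weight (A : BAL.{u}) (a : A) : ℝ := max (balNorm a) 1

theorem abs_le_balNorm {A : BAL.{u}} (a : A) : |a| ≤ algebraMap ℝ A (balNorm a) := le_of_ev fun M => by
  rw [M.ev_abs, M.ev_algebraMap]; exact abs_ev_le_balNorm M a

theorem IsModalMap.balNorm_le {A B : BAL.{u}} {g : A → B} (hg : IsModalMap g) (a : A) :
    balNorm (g a) ≤ weight A a := by
  have mono : ∀ {a b : A}, a ≤ b → g a ≤ g b := fun {a b} hab => by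
    rw [← inf_eq_left, ← hg.map_inf, inf_eq_left.2 hab]
  refine ModalBal.balNorm_le (zero_le_one.trans (le_max_right _ _)) fun M => ?_
  set r := balNorm a
  have hreal : ∀ s : ℝ, M.ev (g (algebraMap ℝ A s)) = s + (1 - s) * M.ev (g 0) := fun s => by
    rw [hg.map_real, M.ev_add, M.ev_mul, M.ev_sub, M.ev_algebraMap,
      ← map_one (algebraMap ℝ B), M.ev_algebraMap]
  have h01 : M.ev (g 0) * M.ev (g 0) = M.ev (g 0) := by
    have := congrArg M.ev (hg.map_real_mul 0 0 le_rfl)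
    rw [map_zero, mul_zero, M.ev_mul] at this
    exact this.symm
  have h1 := M.ev_mono (mono ((le_abs_self a).trans (abs_le_balNorm a)))
  have h2 : algebraMap ℝ A (-r) ≤ a := by
    rw [map_neg, neg_le]; exact (neg_le_abs a).trans (abs_le_balNorm a)
  replace h2 := M.ev_mono (mono h2)
  rw [hreal] at h1 h2
  change |M.ev (g a)| ≤ max r 1
  have hr1 := le_max_left r 1
  have hr2 := le_max_right r 1
  have h3 : M.ev (g 0) = 0 ∨ M.ev (g 0) = 1 := by
    rcases eq_or_ne (M.ev (g 0)) 0 with h | h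
    · exact Or.inl h
    · exact Or.inr (mul_left_cancel₀ h (by rw [h01, mul_one]))
  rw [abs_le]
  rcases h3 with h3 | h3 <;> rw [h3] at h1 h2 <;> constructor <;> linarith

section H

variable (A : BAL.{u})

/-- The elements generating the archimedean `ℓ`-ideal `I_A`. -/
inductive ModalRelation : freeBal (weight A) → Prop
  | inf (a b : A) : ModalRelation
      (freeGen (weight A) (a ⊓ b) - freeGen (weight A) a ⊓ freeGen (weight A) b)
  | real (r : ℝ) : ModalRelation
      (freeGen (weight A) (algebraMap ℝ A r) - algebraMap ℝ _ r -
        (1 - algebraMap ℝ _ r) * freeGen (weight A) (0 : A))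
  | posPart (a : A) : ModalRelation
      (freeGen (weight A) (a ⊔ 0) - freeGen (weight A) a ⊔ 0)
  | add_real (a : A) (r : ℝ) : ModalRelation
      (freeGen (weight A) (a + algebraMap ℝ A r) - freeGen (weight A) a -
        freeGen (weight A) (algebraMap ℝ A r) + freeGen (weight A) (0 : A))
  | real_mul (r : ℝ) (a : A) (hr : 0 ≤ r) : ModalRelation
      (freeGen (weight A) (algebraMap ℝ A r * a) -
        freeGen (weight A) (algebraMap ℝ A r) * freeGen (weight A) a)

/-- The archimedean `ℓ`-ideal `I_A` is generated by the modal relations. -/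
theorem isArchLIdeal_modal : IsArchLIdeal (archSpan {x | ModalRelation A x}) :=
  isArchLIdeal_archSpan _

/-- `H(A) = F(A) / I_A`. -/
noncomputable def hObj : BAL.{u} := quotBal (freeBal (weight A)) (isArchLIdeal_modal A)

/-- The map `h_A : A → H(A)`, `a ↦ □_a`. -/
noncomputable def hGen (a : A) : hObj A :=
  (quotMk (freeBal (weight A)) (isArchLIdeal_modal A)).hom (freeGen (weight A) a)

theorem isModalMap_hGen : IsModalMap (hGen A) := by
  set q := quotMk (freeBal (weight A)) (isArchLIdeal_modal A)
  have key : ∀ x, ModalRelation A x → q.hom x = 0 := fun x hx =>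
    Ideal.Quotient.eq_zero_iff_mem.2 (subset_archSpan _ hx)
  refine ⟨fun a b => ?_, fun r => ?_, fun a => ?_, fun a r => ?_, fun r a hr => ?_⟩
  · have := key _ (.inf a b)
    rw [map_sub, q.map_inf] at this
    exact sub_eq_zero.1 this
  · have := key _ (.real r)
    rw [map_sub, map_sub, map_mul, map_sub, map_one, AlgHom.commutes, sub_sub] at this
    exact sub_eq_zero.1 this
  · have := key _ (.posPart a)
    rw [map_sub, q.map_sup, map_zero] at this
    exact sub_eq_zero.1 this
  · have := key _ (.add_real a r)
    rw [map_add, map_sub, map_sub, sub_sub, sub_add] at this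
    exact sub_eq_zero.1 this
  · have := key _ (.real_mul r a hr)
    rw [map_sub, map_mul] at this
    exact sub_eq_zero.1 this

variable {A}

theorem h_hom_ext {B : BAL.{u}} {f g : hObj A ⟶ B}
    (h : ∀ a, f.hom (hGen A a) = g.hom (hGen A a)) : f = g := by
  have : quotMk _ (isArchLIdeal_modal A) ≫ f = quotMk _ (isArchLIdeal_modal A) ≫ g :=
    free_hom_ext h
  ext x
  obtain ⟨y, rfl⟩ := quotMk_surjective _ (isArchLIdeal_modal A) x
  exact congrArg (fun k : freeBal (weight A) ⟶ B => k.hom y) this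

/-- The morphism `H(A) → B` induced by a map satisfying the modal identities. -/
noncomputable def hLift {B : BAL.{u}} (g : A → B) (hg : IsModalMap g) : hObj A ⟶ B :=
  quotLift (isArchLIdeal_modal A) (freeLift g hg.balNorm_le) (by
    refine archSpan_le (isArchLIdeal_ker (freeLift g hg.balNorm_le)) fun x hx => ?_
    set q := freeLift g hg.balNorm_le with hq
    have hgen : ∀ a, q.hom (freeGen (weight A) a) = g a := freeLift_gen g hg.balNorm_le
    refine RingHom.mem_ker.2 ?_
    induction hx with
    | inf a b => rw [map_sub, q.map_inf, hgen, hgen, hgen, hg.map_inf, sub_self]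
    | real r =>
      rw [map_sub, map_sub, map_mul, map_sub, map_one, AlgHom.commutes, hgen, hgen, hg.map_real]
      ring
    | posPart a => rw [map_sub, q.map_sup, hgen, hgen, map_zero, hg.map_posPart, sub_self]
    | add_real a r =>
      rw [map_add, map_sub, map_sub, hgen, hgen, hgen, hgen, hg.map_add_real]
      ring
    | real_mul r a hr => rw [map_sub, map_mul, hgen, hgen, hgen, hg.map_real_mul r a hr, sub_self])

theorem hLift_gen {B : BAL.{u}} (g : A → B) (hg : IsModalMap g) (a : A) :
    (hLift g hg).hom (hGen A a) = g a := freeLift_gen g hg.balNorm_le a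

theorem IsModalMap.comp_hom {A B D : BAL.{u}} {g : B → D} (hg : IsModalMap g) (f : A ⟶ B) :
    IsModalMap fun a => g (f.hom a) where
  map_inf a b := by rw [f.map_inf, hg.map_inf]
  map_real r := by rw [AlgHom.commutes, hg.map_real, map_zero]
  map_posPart a := by rw [f.map_sup, map_zero, hg.map_posPart]
  map_add_real a r := by rw [map_add, AlgHom.commutes, hg.map_add_real, map_zero]
  map_real_mul r a hr := by rw [map_mul, AlgHom.commutes, hg.map_real_mul r _ hr]

theorem IsModalMap.hom_comp {A B D : BAL.{u}} {g : A → B} (hg : IsModalMap g) (f : B ⟶ D) :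
    IsModalMap fun a => f.hom (g a) where
  map_inf a b := by rw [hg.map_inf, f.map_inf]
  map_real r := by rw [hg.map_real, map_add, map_mul, map_sub, map_one, AlgHom.commutes]
  map_posPart a := by rw [hg.map_posPart, f.map_sup, map_zero]
  map_add_real a r := by rw [hg.map_add_real, map_sub, map_add]
  map_real_mul r a hr := by rw [hg.map_real_mul r a hr, map_mul]

end H

/-- The endofunctor `H` of `baℓ`; `H(f)` is determined by `H(f)(□_a) = □_{f(a)}`. -/
noncomputable def hFunctor : BAL.{u} ⥤ BAL.{u} where
  obj := hObj
  map {A B} f := hLift (fun a => hGen B (f.hom a)) ((isModalMap_hGen B).comp_hom f)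
  map_id A := h_hom_ext fun a => hLift_gen _ _ a
  map_comp f g := h_hom_ext fun a => by
    rw [BAL.comp_hom, hLift_gen, hLift_gen, hLift_gen, BAL.comp_hom]

theorem hFunctor_map_gen {A B : BAL.{u}} (f : A ⟶ B) (a : A) :
    (hFunctor.map f).hom (hGen A a) = hGen B (f.hom a) :=
  hLift_gen _ ((isModalMap_hGen B).comp_hom f) a

/-! ### The Vietoris endofunctor -/

/-- The Vietoris endofunctor of compact Hausdorff spaces. Since `X` is compact Hausdorff, its closed
subsets are its compact subsets, and `Compacts X` is given the Vietoris topology. -/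
def vietoris : CompHaus.{u} ⥤ CompHaus.{u} where
  obj X := CompHaus.of (TopologicalSpace.Compacts X)
  map {X Y} f := CompHausLike.ofHom _
    ⟨TopologicalSpace.Compacts.map f.hom.hom f.hom.hom.continuous, by fun_prop⟩
  map_id X := by
    ext (K : TopologicalSpace.Compacts X) x
    exact iff_of_eq (congrArg (x ∈ ·) (Set.image_id (K : Set X)))
  map_comp {X Y Z} f g := by
    ext (K : TopologicalSpace.Compacts X) x
    exact iff_of_eq (congrArg (x ∈ ·) (Set.image_comp g.hom.hom f.hom.hom (K : Set X)))

/-- `inf f(K)` if `K` is nonempty, and `1` otherwise. -/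
noncomputable def infOrOne {X : Type u} (f : X → ℝ) (K : Set X) : ℝ :=
  open Classical in if K.Nonempty then sInf (f '' K) else 1

section InfOrOne

variable {X : Type u} {f g : X → ℝ} {K : Set X}

theorem infOrOne_empty : infOrOne f ∅ = 1 := if_neg Set.not_nonempty_empty

theorem infOrOne_image {Y : Type u} (φ : Y → X) (L : Set Y) :
    infOrOne f (φ '' L) = infOrOne (f ∘ φ) L := by
  classical
  rw [infOrOne, infOrOne, Set.image_image]
  exact if_congr Set.image_nonempty rfl rfl

theorem exists_infOrOne [TopologicalSpace X] (hf : Continuous f) (hK : IsCompact K)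
    (hne : K.Nonempty) : ∃ x ∈ K, infOrOne f K = f x ∧ ∀ y ∈ K, f x ≤ f y := by
  obtain ⟨x, hx, h⟩ := hK.exists_isMinOn hne hf.continuousOn
  refine ⟨x, hx, ?_, h⟩
  rw [infOrOne, if_pos hne]
  exact IsLeast.csInf_eq ⟨⟨x, hx, rfl⟩, by rintro _ ⟨y, hy, rfl⟩; exact h hy⟩

theorem infOrOne_eq {x : X} (hx : x ∈ K) (h : ∀ y ∈ K, f x ≤ f y) : infOrOne f K = f x := by
  rw [infOrOne, if_pos ⟨x, hx⟩]
  exact IsLeast.csInf_eq ⟨⟨x, hx, rfl⟩, by rintro _ ⟨y, hy, rfl⟩; exact h y hy⟩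

theorem lt_infOrOne [TopologicalSpace X] (hf : Continuous f) (hK : IsCompact K) {r : ℝ} :
    r < infOrOne f K ↔ K ⊆ f ⁻¹' Set.Ioi r ∧ (K.Nonempty ∨ r < 1) := by
  rcases K.eq_empty_or_nonempty with rfl | hne
  · simp [infOrOne_empty]
  · obtain ⟨x, hx, h1, h2⟩ := exists_infOrOne hf hK hne
    rw [h1]
    exact ⟨fun h => ⟨fun y hy => h.trans_le (h2 y hy), Or.inl hne⟩, fun h => h.1 hx⟩

theorem infOrOne_lt [TopologicalSpace X] (hf : Continuous f) (hK : IsCompact K) {r : ℝ} :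
    infOrOne f K < r ↔ (K ∩ f ⁻¹' Set.Iio r).Nonempty ∨ (K ⊆ ∅ ∧ 1 < r) := by
  rcases K.eq_empty_or_nonempty with rfl | hne
  · simp [infOrOne_empty]
  · obtain ⟨x, hx, h1, h2⟩ := exists_infOrOne hf hK hne
    rw [h1]
    refine ⟨fun h => Or.inl ⟨x, hx, h⟩, ?_⟩
    rintro (⟨y, hy, hyr⟩ | ⟨h, -⟩)
    · exact (h2 y hy).trans_lt hyr
    · exact (h hx).elim

end InfOrOne

theorem continuous_infOrOne {X : Type u} [TopologicalSpace X] (f : C(X, ℝ)) :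
    Continuous fun K : TopologicalSpace.Compacts X => infOrOne f K := by
  rw [continuous_iff_lower_upperSemicontinuous, lowerSemicontinuous_iff_isOpen_preimage,
    upperSemicontinuous_iff_isOpen_preimage]
  refine ⟨fun r => ?_, fun r => ?_⟩
  · have : (fun K : TopologicalSpace.Compacts X => infOrOne f K) ⁻¹' Set.Ioi r =
        {K : TopologicalSpace.Compacts X | (K : Set X) ⊆ f ⁻¹' Set.Ioi r} ∩
          ({K : TopologicalSpace.Compacts X | ((K : Set X) ∩ Set.univ).Nonempty} ∪ {_K | r < 1}) := by
      ext K
      simp only [Set.inter_univ]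
      exact lt_infOrOne f.continuous K.isCompact
    rw [this]
    exact (TopologicalSpace.Compacts.isOpen_subsets_of_isOpen
      (isOpen_Ioi.preimage f.continuous)).inter
      ((TopologicalSpace.Compacts.isOpen_inter_nonempty_of_isOpen isOpen_univ).union isOpen_const)
  · have : (fun K : TopologicalSpace.Compacts X => infOrOne f K) ⁻¹' Set.Iio r =
        {K : TopologicalSpace.Compacts X | ((K : Set X) ∩ f ⁻¹' Set.Iio r).Nonempty} ∪
          ({K : TopologicalSpace.Compacts X | (K : Set X) ⊆ ∅} ∩ {_K | 1 < r}) := by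
      ext K
      exact infOrOne_lt f.continuous K.isCompact
    rw [this]
    exact (TopologicalSpace.Compacts.isOpen_inter_nonempty_of_isOpen
      (isOpen_Iio.preimage f.continuous)).union
      ((TopologicalSpace.Compacts.isOpen_subsets_of_isOpen isOpen_empty).inter isOpen_const)

/-- The map `C(X) → C(V(X))` sending `f` to `K ↦ inf f(K)` (and `∅ ↦ 1`). -/
noncomputable def infMap {X : Type u} [TopologicalSpace X] (f : C(X, ℝ)) :
    C(TopologicalSpace.Compacts X, ℝ) :=
  ⟨fun K => infOrOne f K, continuous_infOrOne f⟩

/-- The map `f ↦ (K ↦ inf f(K))` (and `∅ ↦ 1`), between objects of `baℓ`. -/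
noncomputable def boxVietoris (X : CompHaus.{u}) (f : contAlg X) : contAlg (vietoris.obj X) :=
  infMap (X := X) f

theorem isModalMap_boxVietoris (X : CompHaus.{u}) : IsModalMap (boxVietoris X) := by
  have ext : ∀ {a b : C(TopologicalSpace.Compacts X, ℝ)},
      (∀ K : TopologicalSpace.Compacts X, (K : Set X) = ∅ → a K = b K) →
      (∀ K : TopologicalSpace.Compacts X, (K : Set X).Nonempty → a K = b K) → a = b :=
    fun h1 h2 => ContinuousMap.ext fun K =>
      (Set.eq_empty_or_nonempty (K : Set X)).elim (h1 K) (h2 K)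
  have val0 : ∀ (f : C(X, ℝ)) (K : TopologicalSpace.Compacts X), (K : Set X) = ∅ →
      infMap f K = 1 := fun f K hK => by
    change infOrOne _ (K : Set X) = 1
    rw [hK, infOrOne_empty]
  have val : ∀ (f : C(X, ℝ)) (K : TopologicalSpace.Compacts X), (K : Set X).Nonempty →
      ∃ x ∈ (K : Set X), infMap f K = f x ∧
        ∀ y ∈ (K : Set X), f x ≤ f y := fun f K hK => exists_infOrOne f.continuous K.isCompact hK
  have val' : ∀ (f : C(X, ℝ)) (K : TopologicalSpace.Compacts X) (x : X), x ∈ (K : Set X) →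
      (∀ y ∈ (K : Set X), f x ≤ f y) →
      infMap f K = f x := fun f K x hx h =>
    infOrOne_eq hx h
  have valr : ∀ (r : ℝ) (K : TopologicalSpace.Compacts X), (K : Set X).Nonempty →
      infMap (algebraMap ℝ C(X, ℝ) r) K = r :=
    fun r K ⟨x, hx⟩ => val' (algebraMap ℝ C(X, ℝ) r) K x hx fun y _ => le_rfl
  have valz : ∀ (K : TopologicalSpace.Compacts X), (K : Set X).Nonempty →
      infMap (0 : C(X, ℝ)) K = 0 :=
    fun K ⟨x, hx⟩ => val' (0 : C(X, ℝ)) K x hx fun y _ => le_rfl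
  refine ⟨fun (f g : C(X, ℝ)) => ext (fun K hK => ?_) (fun K hK => ?_),
    fun r => ext (fun K hK => ?_) (fun K hK => ?_),
    fun (f : C(X, ℝ)) => ext (fun K hK => ?_) (fun K hK => ?_),
    fun (f : C(X, ℝ)) r => ext (fun K hK => ?_) (fun K hK => ?_),
    fun r (f : C(X, ℝ)) hr => ext (fun K hK => ?_) (fun K hK => ?_)⟩
  · refine (val0 _ K hK).trans (Eq.symm ?_)
    exact (congrArg₂ min (val0 f K hK) (val0 g K hK)).trans (min_self _)
  · obtain ⟨x, hx, h1, h2⟩ := val f K hK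
    obtain ⟨y, hy, h3, h4⟩ := val g K hK
    refine Eq.trans ?_ (congrArg₂ min h1 h3).symm
    rcases le_total (f x) (g y) with h | h
    · rw [min_eq_left h]
      refine (val' (f ⊓ g) K x hx fun z hz => ?_).trans (min_eq_left (h.trans (h4 x hx)))
      exact (min_le_left _ _).trans (le_min (h2 z hz) (h.trans (h4 z hz)))
    · rw [min_eq_right h]
      refine (val' (f ⊓ g) K y hy fun z hz => ?_).trans (min_eq_right (h.trans (h2 y hy)))
      exact (min_le_right _ _).trans (le_min (h.trans (h2 z hz)) (h4 z hz))
  · refine (val0 _ K hK).trans ?_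
    change 1 = r + (1 - r) * _
    erw [val0 _ K hK]
    ring
  · refine (valr r K hK).trans ?_
    change r = r + (1 - r) * _
    erw [valz K hK]
    ring
  · refine (val0 _ K hK).trans (Eq.symm ?_)
    exact (congrArg (max · 0) (val0 f K hK)).trans (max_eq_left zero_le_one)
  · obtain ⟨x, hx, h1, h2⟩ := val f K hK
    refine (val' (f ⊔ 0) K x hx fun z hz => max_le_max (h2 z hz) le_rfl).trans ?_
    exact (congrArg (max · 0) h1).symm
  · refine (val0 _ K hK).trans (Eq.symm ?_)
    refine (congrArg₂ (· - ·) (congrArg₂ (· + ·) (val0 f K hK) (val0 _ K hK)) (val0 0 K hK)).trans ?_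
    norm_num
  · obtain ⟨x, hx, h1, h2⟩ := val f K hK
    refine (val' (f + algebraMap ℝ C(X, ℝ) r) K x hx fun z hz =>
      _root_.add_le_add_left (h2 z hz) r).trans (Eq.symm ?_)
    refine (congrArg₂ (· - ·) (congrArg₂ (· + ·) h1 (valr r K hK)) (valz K hK)).trans ?_
    exact sub_zero _
  · refine (val0 _ K hK).trans (Eq.symm ?_)
    exact (congrArg₂ (· * ·) (val0 _ K hK) (val0 f K hK)).trans (one_mul _)
  · obtain ⟨x, hx, h1, h2⟩ := val f K hK
    refine (val' (algebraMap ℝ C(X, ℝ) r * f) K x hx fun z hz =>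
      mul_le_mul_of_nonneg_left (h2 z hz) hr).trans (Eq.symm ?_)
    exact congrArg₂ (· * ·) (valr r K hK) h1

/-- `g_A : A → C(V(Y_A))`, `g_A(a)(F) = inf ζ_A(a)(F)` for `F ≠ ∅` and `g_A(a)(∅) = 1`. -/
noncomputable def gMap (A : BAL.{u}) (a : A) : contAlg (vietoris.obj (yosida A)) :=
  boxVietoris (yosida A) ((zeta A).hom a)

theorem isModalMap_gMap (A : BAL.{u}) : IsModalMap (gMap A) :=
  (isModalMap_boxVietoris (yosida A)).comp_hom (zeta A)

/-- `η_A : H(A) → C(V(Y_A))` is the morphism with `η_A ∘ h_A = g_A`. -/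
noncomputable def eta (A : BAL.{u}) : hFunctor.obj A ⟶ contAlg (vietoris.obj (yosida A)) :=
  hLift (gMap A) (isModalMap_gMap A)

theorem eta_gen (A : BAL.{u}) (a : A) : (eta A).hom (hGen A a) = gMap A a := hLift_gen _ _ a

/-! ### The Yosida space of `H(A)` is the Vietoris space of the Yosida space of `A` -/

theorem yosidaMap_comp {A B D : BAL.{u}} (f : A ⟶ B) (g : B ⟶ D) :
    yosidaMap (f ≫ g) = yosidaMap g ≫ yosidaMap f := rfl

theorem yosidaMap_id (A : BAL.{u}) : yosidaMap (𝟙 A) = 𝟙 (yosida A) := rfl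

theorem contMap_comp {X Y Z : CompHaus.{u}} (f : X ⟶ Y) (g : Y ⟶ Z) :
    contMap (f ≫ g) = contMap g ≫ contMap f := rfl

theorem epsilon_naturality {X Y : CompHaus.{u}} (φ : X ⟶ Y) :
    epsilon X ≫ yosidaMap (contMap φ) = φ ≫ epsilon Y := rfl

theorem eta_naturality {A B : BAL.{u}} (f : A ⟶ B) :
    hFunctor.map f ≫ eta B = eta A ≫ contMap (vietoris.map (yosidaMap f)) := by
  refine h_hom_ext fun a => ?_
  change (eta B).hom ((hFunctor.map f).hom (hGen A a)) =
    (contMap (vietoris.map (yosidaMap f))).hom ((eta A).hom (hGen A a))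
  rw [hFunctor_map_gen, eta_gen, eta_gen]
  refine ContinuousMap.ext fun (K : TopologicalSpace.Compacts (Yosida B)) => ?_
  change infOrOne (fun M : Yosida B => M.ev (f.hom a)) K =
    infOrOne (fun M : Yosida A => M.ev a) (Yosida.comap f '' K)
  rw [infOrOne_image]
  congr 1
  ext M
  exact (Yosida.ev_comap f M a).symm

/-- A closed set of maximal `ℓ`-ideals and a point outside it are separated by an element. -/
theorem exists_separating_element {A : BAL.{u}} {K : Set (Yosida A)} (hK : IsClosed K)
    {y : Yosida A} (hy : y ∉ K) : ∃ a : A, 0 ≤ a ∧ y.ev a = 0 ∧ ∀ z ∈ K, z.ev a = 1 := by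
  obtain ⟨I, -, rfl⟩ := isClosed_iff_zeroLocus.1 hK
  obtain ⟨b, hb, hby⟩ := Set.not_subset.1 hy
  have hb0 : y.ev b ≠ 0 := fun h => hby (y.ev_eq_zero.1 h)
  have h : ∀ z : Yosida A, z.ev |1 - algebraMap ℝ A (y.ev b)⁻¹ * b| = |1 - (y.ev b)⁻¹ * z.ev b| :=
    fun z => by
      rw [z.ev_abs, z.ev_sub, z.ev_mul, z.ev_algebraMap, ← map_one (algebraMap ℝ A),
        z.ev_algebraMap]
  refine ⟨|1 - algebraMap ℝ A (y.ev b)⁻¹ * b|, abs_nonneg _, ?_, fun z hz => ?_⟩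
  · rw [h, inv_mul_cancel₀ hb0, sub_self, abs_zero]
  · rw [h, z.ev_eq_zero.2 (hz hb), mul_zero, sub_zero, abs_one]

theorem ev_ext_hGen {A : BAL.{u}} {M N : Yosida (hObj A)}
    (h : ∀ a, M.ev (hGen A a) = N.ev (hGen A a)) : M = N := by
  let pt : Yosida (hObj A) → (CompHaus.of PUnit.{u + 1} ⟶ yosida (hObj A)) := fun M =>
    CompHausLike.ofHom _ ⟨fun _ => M, continuous_const⟩
  have : zeta (hObj A) ≫ contMap (pt M) = zeta (hObj A) ≫ contMap (pt N) :=
    h_hom_ext fun a => ContinuousMap.ext fun _ => h a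
  refine Yosida.ext_ev fun x => ?_
  have h2 := congrArg (fun k : hObj A ⟶ contAlg (CompHaus.of PUnit.{u + 1}) => k.hom x) this
  exact congrArg (fun k : C(PUnit.{u + 1}, ℝ) => k PUnit.unit) h2

section ModalFunctional

variable {A B : BAL.{u}} {g : A → B} (hg : IsModalMap g) (x : Yosida B)

/-- The set `{y | ∀ a, x(g(a)) ≤ y(a)}`. -/
def lowerSet (g : A → B) (x : Yosida B) : Set (Yosida A) := {y | ∀ a, x.ev (g a) ≤ y.ev a}

theorem isClosed_lowerSet : IsClosed (lowerSet g x) := by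
  simp only [lowerSet, Set.ofPred_forall]
  exact isClosed_iInter fun a => isClosed_le continuous_const (Yosida.continuous_ev a)

theorem modal_zero (hg : IsModalMap g) : x.ev (g 0) = 0 ∨ x.ev (g 0) = 1 := by
  have := congrArg x.ev (hg.map_real_mul 0 0 le_rfl)
  rw [map_zero, mul_zero, x.ev_mul] at this
  rcases eq_or_ne (x.ev (g 0)) 0 with h | h
  · exact Or.inl h
  · exact Or.inr (mul_left_cancel₀ h (by rw [← this, mul_one]))

theorem modal_eq_one (hg : IsModalMap g) (h : x.ev (g 0) = 1) (a : A) : x.ev (g a) = 1 := by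
  have := congrArg x.ev (hg.map_real_mul 0 a le_rfl)
  rw [map_zero, zero_mul, x.ev_mul, h, one_mul] at this
  exact this.symm

theorem modal_real (hg : IsModalMap g) (h : x.ev (g 0) = 0) (r : ℝ) :
    x.ev (g (algebraMap ℝ A r)) = r := by
  rw [hg.map_real, x.ev_add, x.ev_mul, h, mul_zero, add_zero, x.ev_algebraMap]

theorem modal_add_real (hg : IsModalMap g) (h : x.ev (g 0) = 0) (a : A) (r : ℝ) :
    x.ev (g (a + algebraMap ℝ A r)) = x.ev (g a) + r := by
  rw [hg.map_add_real, x.ev_sub, x.ev_add, h, sub_zero, modal_real x hg h]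

theorem modal_real_mul (hg : IsModalMap g) (h : x.ev (g 0) = 0) {r : ℝ} (hr : 0 ≤ r) (a : A) :
    x.ev (g (algebraMap ℝ A r * a)) = r * x.ev (g a) := by
  rw [hg.map_real_mul r a hr, x.ev_mul, modal_real x hg h]

theorem modal_posPart (hg : IsModalMap g) (a : A) : x.ev (g (a ⊔ 0)) = x.ev (g a) ⊔ 0 := by
  rw [hg.map_posPart, x.ev_posPart]

theorem modal_mono (hg : IsModalMap g) {a b : A} (hab : a ≤ b) : x.ev (g a) ≤ x.ev (g b) := by
  refine x.ev_mono ?_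
  rw [← inf_eq_left, ← hg.map_inf, inf_eq_left.2 hab]

theorem exists_mem_lowerSet (hg : IsModalMap g) (h0 : x.ev (g 0) = 0) (a : A) :
    ∃ y ∈ lowerSet g x, y.ev a ≤ x.ev (g a) := by
  by_contra! hcon
  obtain ⟨t, ht⟩ := (Yosida.isClosed_ev_le a (x.ev (g a))).isCompact.elim_finite_subfamily_closed
    (fun b : A => {y : Yosida A | x.ev (g b) ≤ y.ev b})
    (fun b => isClosed_le continuous_const (Yosida.continuous_ev b)) (by
      refine Set.eq_empty_of_forall_notMem fun y hy => ?_
      exact absurd (hcon y (Set.mem_iInter.1 hy.2)) (not_lt.2 hy.1))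
  obtain ⟨d, hd0, hd⟩ : ∃ d : A, x.ev (g d) = 0 ∧
      ∀ y : Yosida A, 0 ≤ y.ev d → ∀ b ∈ t, x.ev (g b) ≤ y.ev b := by
    clear ht
    classical
    induction t using Finset.induction_on with
    | empty => exact ⟨0, h0, by simp⟩
    | insert b s _ ih =>
      obtain ⟨d, hd0, hd⟩ := ih
      refine ⟨d ⊓ (b + algebraMap ℝ A (-x.ev (g b))), ?_, fun y hy => ?_⟩
      · rw [hg.map_inf, x.ev_inf, hd0, modal_add_real x hg h0, add_neg_cancel, min_self]
      · rw [y.ev_inf, le_inf_iff, y.ev_add, y.ev_algebraMap] at hy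
        rw [Finset.forall_mem_insert]
        exact ⟨by linarith [hy.2], hd y hy.1⟩
  set c : A := a + algebraMap ℝ A (-x.ev (g a))
  have hc0 : x.ev (g c) = 0 := by rw [modal_add_real x hg h0, add_neg_cancel]
  have hpos : ∀ y : Yosida A, 0 < max (-y.ev d) (y.ev c) := fun y => by
    by_contra! h
    obtain ⟨h1, h2⟩ := max_le_iff.1 h
    have : y ∈ {y : Yosida A | y.ev a ≤ x.ev (g a)} ∩ ⋂ b ∈ t, {y | x.ev (g b) ≤ y.ev b} := by
      refine ⟨?_, Set.mem_iInter₂.2 (hd y (by linarith))⟩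
      rw [y.ev_add, y.ev_algebraMap] at h2
      exact (by linarith : y.ev a ≤ x.ev (g a))
    rw [ht] at this
    exact this
  obtain ⟨δ, hδ, hmin⟩ : ∃ δ : ℝ, 0 < δ ∧ ∀ y : Yosida A, δ ≤ max (-y.ev d) (y.ev c) := by
    rcases isEmpty_or_nonempty (Yosida A) with hA | hA
    · exact ⟨1, one_pos, fun y => hA.elim y⟩
    · obtain ⟨y, -, hy⟩ := isCompact_univ.exists_isMinOn (Set.univ_nonempty (α := Yosida A))
        ((Yosida.continuous_ev d).neg.max (Yosida.continuous_ev c)).continuousOn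
      exact ⟨_, hpos y, fun z => hy (Set.mem_univ z)⟩
  set m : ℝ := balNorm d + δ
  have hm : ∀ y : Yosida A, y.ev d + δ ≤ m := fun y =>
    add_le_add_left ((le_abs_self _).trans (abs_ev_le_balNorm y d)) δ
  have hm0 : 0 ≤ m := by
    obtain ⟨n, hn⟩ := IsBal.bounded |d|
    have : 0 ≤ balNorm d := Real.sInf_nonneg (by
      intro r hr
      by_contra! hlt
      obtain hA | ⟨⟨y⟩⟩ := isEmpty_or_nonempty (Yosida A)
      · have h1 : algebraMap ℝ A 1 = 0 := eq_of_ev fun y => hA.elim y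
        have h2 := modal_real x hg h0 1
        rw [h1, h0] at h2
        exact zero_ne_one h2
      · have := y.ev_mono hr
        rw [y.ev_abs, ← Algebra.algebraMap_eq_smul_one, y.ev_algebraMap] at this
        exact absurd ((abs_nonneg _).trans this) (not_le.2 hlt))
    positivity
  have hle : algebraMap ℝ A δ * ((d + algebraMap ℝ A δ) ⊔ 0) ≤ algebraMap ℝ A m * (c ⊔ 0) :=
    le_of_ev fun y => by
      rw [y.ev_mul, y.ev_mul, y.ev_posPart, y.ev_posPart, y.ev_add, y.ev_algebraMap,
        y.ev_algebraMap]
      rcases le_total (y.ev d + δ) 0 with h | h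
      · rw [max_eq_right h, mul_zero]
        exact mul_nonneg hm0 (le_max_right _ _)
      · rw [max_eq_left h]
        rcases le_max_iff.1 (hmin y) with h1 | h1
        · have : y.ev d + δ = 0 := by linarith
          rw [this, mul_zero]
          exact mul_nonneg hm0 (le_max_right _ _)
        · calc δ * (y.ev d + δ) ≤ δ * m := mul_le_mul_of_nonneg_left (hm y) hδ.le
            _ = m * δ := mul_comm _ _
            _ ≤ _ := mul_le_mul_of_nonneg_left (h1.trans (le_max_left _ _)) hm0
  have := modal_mono x hg hle
  rw [modal_real_mul x hg h0 hδ.le, modal_real_mul x hg h0 hm0, modal_posPart x hg,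
    modal_posPart x hg, modal_add_real x hg h0, hc0, hd0, zero_add, max_self, mul_zero,
    max_eq_left hδ.le] at this
  exact absurd this (not_le.2 (mul_pos hδ hδ))

theorem infOrOne_lowerSet (hg : IsModalMap g) (a : A) :
    infOrOne (fun y : Yosida A => y.ev a) (lowerSet g x) = x.ev (g a) := by
  rcases modal_zero x hg with h | h
  · obtain ⟨y, hy, hya⟩ := exists_mem_lowerSet x hg h a
    rw [infOrOne_eq hy fun z hz => hya.trans (hz a)]
    exact le_antisymm hya (hy a)
  · have : lowerSet g x = ∅ := Set.eq_empty_of_forall_notMem fun y hy => by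
      have h1 := hy (algebraMap ℝ A 0)
      rw [y.ev_algebraMap, modal_eq_one x hg h] at h1
      exact absurd h1 (by norm_num)
    rw [this, infOrOne_empty, modal_eq_one x hg h]

/-- The closed set of those `y` with `x(g(a)) ≤ y(a)` for all `a`. -/
def lowerCompact (g : A → B) (x : Yosida B) : TopologicalSpace.Compacts (Yosida A) :=
  ⟨lowerSet g x, (isClosed_lowerSet x).isCompact⟩

end ModalFunctional

theorem infOrOne_injective {A : BAL.{u}} {K L : TopologicalSpace.Compacts (Yosida A)}
    (h : ∀ a : A, infOrOne (fun y : Yosida A => y.ev a) K = infOrOne (fun y : Yosida A => y.ev a) L) :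
    K = L := by
  have key : ∀ {K L : TopologicalSpace.Compacts (Yosida A)}, (∀ a : A,
      infOrOne (fun y : Yosida A => y.ev a) K = infOrOne (fun y : Yosida A => y.ev a) L) →
      (K : Set (Yosida A)) ⊆ L := fun {K L} h y hy => by
    by_contra hyL
    obtain ⟨a, ha0, hay, haL⟩ := exists_separating_element L.isCompact.isClosed hyL
    have h1 : infOrOne (fun y : Yosida A => y.ev a) K = 0 :=
      (infOrOne_eq hy fun z _ => hay.trans_le (z.ev_nonneg ha0)).trans hay
    have h2 : infOrOne (fun y : Yosida A => y.ev a) L = 1 := by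
      rcases (L : Set (Yosida A)).eq_empty_or_nonempty with hL | ⟨z, hz⟩
      · rw [hL, infOrOne_empty]
      · exact (infOrOne_eq hz fun w hw => by rw [haL z hz, haL w hw]).trans (haL z hz)
    rw [h, h2] at h1
    exact one_ne_zero h1
  exact TopologicalSpace.Compacts.ext (Set.Subset.antisymm (key h) (key fun a => (h a).symm))

theorem ev_comap_eta (A : BAL.{u}) (K : TopologicalSpace.Compacts (Yosida A)) (a : A) :
    (Yosida.comap (eta A) (pointIdeal (X := vietoris.obj (yosida A)) K)).ev (hGen A a) =
      infOrOne (fun y : Yosida A => y.ev a) K := by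
  refine (Yosida.ev_comap (eta A) _ (hGen A a)).trans ?_
  rw [eta_gen]
  exact Yosida.ev_ofHom (A := C(TopologicalSpace.Compacts (Yosida A), ℝ)) _ _ _

theorem comap_eta_lowerCompact {A : BAL.{u}} (N : Yosida (hObj A)) :
    Yosida.comap (eta A) (pointIdeal (X := vietoris.obj (yosida A)) (lowerCompact (hGen A) N)) = N :=
  ev_ext_hGen fun a => (ev_comap_eta A _ a).trans (infOrOne_lowerSet N (isModalMap_hGen A) a)

instance (A : BAL.{u}) : IsIso (yosidaMap (eta A)) := by
  have h : IsIso (epsilon (vietoris.obj (yosida A)) ≫ yosidaMap (eta A)) := by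
    refine CompHausLike.isIso_of_bijective _
      ⟨fun K L hKL => ?_, fun N => ⟨_, comap_eta_lowerCompact N⟩⟩
    exact infOrOne_injective fun a => (ev_comap_eta A K a).symm.trans
      ((congrArg (fun N : Yosida (hObj A) => N.ev (hGen A a)) hKL).trans (ev_comap_eta A L a))
  exact IsIso.of_isIso_comp_left (epsilon (vietoris.obj (yosida A))) _

/-! ### Modal algebras and compact Hausdorff frames -/

/-- An object of `mbaℓ`: a bounded archimedean `ℓ`-algebra with a modal operator. -/
structure MBAL : Type (u + 1) where
  toBAL : BAL.{u}
  box : toBAL → toBAL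
  isModal : IsModalMap box

namespace MBAL

/-- A unital `ℓ`-algebra morphism preserving the modal operator. -/
@[ext]
structure Hom (A B : MBAL.{u}) : Type u where
  toHom : A.toBAL ⟶ B.toBAL
  map_box : ∀ a, toHom.hom (A.box a) = B.box (toHom.hom a)

instance : Category MBAL.{u} where
  Hom := Hom
  id A := ⟨𝟙 A.toBAL, fun _ => rfl⟩
  comp f g := ⟨f.toHom ≫ g.toHom, fun a => by
    rw [BAL.comp_hom, BAL.comp_hom, f.map_box, g.map_box]⟩

@[ext]
theorem hom_ext {A B : MBAL.{u}} {f g : A ⟶ B} (h : f.toHom = g.toHom) : f = g := Hom.ext h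

/-- `(A, □)` is an object of `mubaℓ` if `A` is uniformly complete. -/
def uniformlyComplete : ObjectProperty MBAL.{u} := fun A => IsUniformlyComplete A.toBAL

end MBAL

/-- The full subcategory `mubaℓ` of `mbaℓ`. -/
abbrev MUBAL : Type (u + 1) := MBAL.uniformlyComplete.{u}.FullSubcategory

/-- A continuous relation. -/
structure IsContinuousRel {X : Type u} [TopologicalSpace X] (R : X → X → Prop) : Prop where
  isClosed_image : ∀ x, IsClosed {y | R x y}
  isClosed_preimage : ∀ F : Set X, IsClosed F → IsClosed {x | ∃ y ∈ F, R x y}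
  isOpen_preimage : ∀ U : Set X, IsOpen U → IsOpen {x | ∃ y ∈ U, R x y}

/-- A compact Hausdorff frame. -/
structure KHF : Type (u + 1) where
  space : CompHaus.{u}
  rel : space → space → Prop
  isContinuous : IsContinuousRel rel

namespace KHF

/-- A continuous bounded morphism: a continuous map `f` with `f(R[x]) = S[f(x)]` for all `x`. -/
@[ext]
structure Hom (X Y : KHF.{u}) : Type u where
  toHom : X.space ⟶ Y.space
  image_rel : ∀ x : X.space, toHom '' {y | X.rel x y} = {z | Y.rel (toHom x) z}

instance : Category KHF.{u} where
  Hom := Hom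
  id X := ⟨𝟙 X.space, fun _ => Set.image_id _⟩
  comp {X Y Z} f g := ⟨f.toHom ≫ g.toHom, fun x => by
    refine Eq.trans ?_ (g.image_rel (f.toHom x))
    rw [← f.image_rel x]
    exact Set.image_comp g.toHom f.toHom _⟩

@[ext]
theorem hom_ext {X Y : KHF.{u}} {f g : X ⟶ Y} (h : f.toHom = g.toHom) : f = g := Hom.ext h

end KHF

/-- The category `Alg(H)` of algebras for `H`. -/
abbrev AlgH : Type (u + 1) := Endofunctor.Algebra hFunctor.{u}

/-- The category `Coalg(V)` of coalgebras for the Vietoris endofunctor. -/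
abbrev CoalgV : Type (u + 1) := Endofunctor.Coalgebra vietoris.{u}

/-! ### `Alg(H)` and `mbaℓ` -/

/-- `M : Alg(H) → mbaℓ`, `(A, σ) ↦ (A, a ↦ σ(□_a))`. -/
noncomputable def functorM : AlgH.{u} ⥤ MBAL.{u} where
  obj P :=
    { toBAL := P.a
      box := fun a => P.str.hom (hGen P.a a)
      isModal := (isModalMap_hGen P.a).hom_comp P.str }
  map {P Q} f :=
    { toHom := f.f
      map_box := fun a => by
        have := congrArg (fun k : hFunctor.obj P.a ⟶ Q.a => k.hom (hGen P.a a)) f.h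
        change Q.str.hom ((hFunctor.map f.f).hom (hGen P.a a)) = _ at this
        rw [hFunctor_map_gen] at this
        exact this.symm }

/-- `N : mbaℓ → Alg(H)`, `(A, □) ↦ (A, σ_□)` with `σ_□(□_a) = □a`. -/
noncomputable def functorN : MBAL.{u} ⥤ AlgH.{u} where
  obj A := ⟨A.toBAL, hLift A.box A.isModal⟩
  map {A B} f :=
    { f := f.toHom
      h := h_hom_ext fun a => by
        change (hLift B.box B.isModal).hom ((hFunctor.map f.toHom).hom (hGen A.toBAL a)) =
          f.toHom.hom ((hLift A.box A.isModal).hom (hGen A.toBAL a))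
        rw [hFunctor_map_gen, hLift_gen, hLift_gen, f.map_box] }

/-! ### `Alg(H)` and `Coalg(V)` -/

/-- `F_α = ε⁻¹ ∘ Y(η_A)⁻¹ ∘ Y(α) : Y_A → V(Y_A)`. -/
noncomputable def strF {A : BAL.{u}} (α : hFunctor.obj A ⟶ A) :
    yosida A ⟶ vietoris.obj (yosida A) :=
  yosidaMap α ≫ inv (yosidaMap (eta A)) ≫ inv (epsilon (vietoris.obj (yosida A)))

theorem strF_comp {A : BAL.{u}} (α : hFunctor.obj A ⟶ A) :
    strF α ≫ epsilon (vietoris.obj (yosida A)) ≫ yosidaMap (eta A) = yosidaMap α := by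
  simp [strF]

/-- The contravariant functor `F : Alg(H) → Coalg(V)`. -/
noncomputable def functorF : AlgH.{u} ⥤ CoalgV.{u}ᵒᵖ where
  obj P := Opposite.op ⟨yosida P.a, strF P.str⟩
  map {P Q} f := Quiver.Hom.op
    { f := yosidaMap f.f
      h := by
        change strF Q.str ≫ vietoris.map (yosidaMap f.f) = yosidaMap f.f ≫ strF P.str
        rw [← cancel_mono (epsilon (vietoris.obj (yosida P.a)) ≫ yosidaMap (eta P.a)),
          Category.assoc, Category.assoc, strF_comp,
          ← Category.assoc (vietoris.map _), ← epsilon_naturality, Category.assoc,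
          ← yosidaMap_comp, ← eta_naturality, yosidaMap_comp, ← Category.assoc (epsilon _),
          ← Category.assoc, strF_comp, ← yosidaMap_comp, ← yosidaMap_comp, f.h] }

/-- `G_σ = C(σ) ∘ C(V(ε_X)) ∘ η_{C(X)} : H(C(X)) → C(X)`. -/
noncomputable def strG {X : CompHaus.{u}} (σ : X ⟶ vietoris.obj X) :
    hFunctor.obj (contAlg X) ⟶ contAlg X :=
  eta (contAlg X) ≫ contMap (vietoris.map (epsilon X)) ≫ contMap σ

theorem zeta_epsilon {X : CompHaus.{u}} (f : C(X, ℝ)) (x : X) :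
    (pointIdeal x).ev (f : contAlg X) = f x := Yosida.ev_ofHom (A := C(X, ℝ)) _ _ _

theorem strG_gen {X : CompHaus.{u}} (σ : X ⟶ vietoris.obj X) (f : contAlg X) :
    (strG σ).hom (hGen (contAlg X) f) = (contMap σ).hom (boxVietoris X f) := by
  change (contMap σ).hom ((contMap (vietoris.map (epsilon X))).hom
    ((eta (contAlg X)).hom (hGen (contAlg X) f))) = _
  rw [eta_gen]
  refine congrArg (contMap σ).hom
    (ContinuousMap.ext fun (K : TopologicalSpace.Compacts X) => ?_)
  let f' : C(X, ℝ) := f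
  change infOrOne (fun M : Yosida (contAlg X) => M.ev f) (pointIdeal '' (K : Set X)) =
    infOrOne f' (K : Set X)
  rw [infOrOne_image]
  congr 1
  ext x
  exact zeta_epsilon f x

theorem boxVietoris_naturality {X Y : CompHaus.{u}} (φ : X ⟶ Y) (f : contAlg Y) :
    (contMap (vietoris.map φ)).hom (boxVietoris Y f) = boxVietoris X ((contMap φ).hom f) :=
  ContinuousMap.ext fun (K : TopologicalSpace.Compacts X) => by
    let f' : C(Y, ℝ) := f
    exact infOrOne_image (f := f') φ.hom.hom (K : Set X)

/-- The contravariant functor `G : Coalg(V) → Alg(H)`. -/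
noncomputable def functorG : CoalgV.{u}ᵒᵖ ⥤ AlgH.{u} where
  obj P := ⟨contAlg P.unop.V, strG P.unop.str⟩
  map {P Q} f :=
    { f := contMap f.unop.f
      h := h_hom_ext fun a => by
        change (strG Q.unop.str).hom ((hFunctor.map (contMap f.unop.f)).hom
            (hGen (contAlg P.unop.V) a)) =
          (contMap f.unop.f).hom ((strG P.unop.str).hom (hGen (contAlg P.unop.V) a))
        rw [hFunctor_map_gen, strG_gen, strG_gen, ← boxVietoris_naturality]
        exact congrArg (fun k : Q.unop.V ⟶ vietoris.obj P.unop.V =>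
          (contMap k).hom (boxVietoris P.unop.V a)) f.unop.h }

/-! ### `Coalg(V)` and `KHF` -/

/-- The value of a map `σ : X → V(Y)`, as a closed (equivalently, compact) subset of `Y`. -/
def valueSet {X Y : CompHaus.{u}} (σ : X ⟶ vietoris.obj Y) (x : X) :
    TopologicalSpace.Compacts Y := σ.hom.hom x

theorem isContinuousRel_of_coalg {X : CompHaus.{u}} (σ : X ⟶ vietoris.obj X) :
    IsContinuousRel fun x y : X => y ∈ valueSet σ x := by
  have hσ : Continuous (valueSet σ) := σ.hom.hom.continuous
  have hop : ∀ U : Set X, IsOpen U →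
      IsOpen {x : X | ∃ y ∈ U, y ∈ valueSet σ x} := fun U hU => by
    convert (TopologicalSpace.Compacts.isOpen_inter_nonempty_of_isOpen hU).preimage hσ using 1
    ext x
    exact ⟨fun ⟨y, h1, h2⟩ => ⟨y, h2, h1⟩, fun ⟨y, h1, h2⟩ => ⟨y, h2, h1⟩⟩
  refine ⟨fun x => (valueSet σ x).isCompact.isClosed, fun F hF => ?_, hop⟩
  rw [← isOpen_compl_iff]
  convert (TopologicalSpace.Compacts.isOpen_subsets_of_isOpen hF.isOpen_compl).preimage hσ using 1
  ext x
  exact ⟨fun h y hy hyF => h ⟨y, hyF, hy⟩, fun h ⟨y, hyF, hy⟩ => h hy hyF⟩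

/-- `S : Coalg(V) → KHF`, `(X, σ) ↦ (X, R_σ)` with `x R_σ y` iff `y ∈ σ(x)`. -/
def functorS : CoalgV.{u} ⥤ KHF.{u} where
  obj P :=
    { space := P.V
      rel := fun x y => y ∈ valueSet P.str x
      isContinuous := isContinuousRel_of_coalg P.str }
  map {P Q} f :=
    { toHom := f.f
      image_rel := fun x => congrArg (fun k : P.V ⟶ vietoris.obj Q.V =>
        (valueSet k x : Set Q.V)) f.h }

/-- `σ_R : X → V(X)`, `σ_R(x) = R[x]`. -/
def strT (X : KHF.{u}) : X.space ⟶ vietoris.obj X.space :=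
  CompHausLike.ofHom _
    ⟨fun x => (⟨{y | X.rel x y}, (X.isContinuous.isClosed_image x).isCompact⟩ :
      TopologicalSpace.Compacts X.space), by
      let _ := TopologicalSpace.vietoris X.space
      rw [TopologicalSpace.Compacts.isEmbedding_coe.continuous_iff]
      refine TopologicalSpace.vietoris.continuous_iff.2 ?_
      refine ⟨fun U hU => ?_, fun F hF => ?_⟩
      · rw [← isClosed_compl_iff]
        convert X.isContinuous.isClosed_preimage Uᶜ hU.isClosed_compl using 1
        ext x
        simp [Set.subset_def, and_comm]
      · rw [← isOpen_compl_iff]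
        convert X.isContinuous.isOpen_preimage Fᶜ hF.isOpen_compl using 1
        ext x
        simp [Set.subset_def, and_comm]⟩

/-- `T : KHF → Coalg(V)`, `(X, R) ↦ (X, σ_R)` with `σ_R(x) = R[x]`. -/
def functorT : KHF.{u} ⥤ CoalgV.{u} where
  obj X := ⟨X.space, strT X⟩
  map {X Y} f :=
    { f := f.toHom
      h := by
        ext x
        exact TopologicalSpace.Compacts.ext (α := Y.space) (f.image_rel x) }

/-! ### The functors between `mbaℓ` and `KHF` -/

/-- The relation `R_□` on `Y_A`: `x R_□ y` iff `0 ≤ a ∈ y` implies `□a ∈ x`. -/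
def boxRel (A : MBAL.{u}) (x y : Yosida A.toBAL) : Prop :=
  ∀ a : A.toBAL, 0 ≤ a → a ∈ y → A.box a ∈ x

theorem strF_hLift (A : MBAL.{u}) (x : Yosida A.toBAL) :
    valueSet (Y := yosida A.toBAL) (strF (hLift A.box A.isModal)) x = lowerCompact A.box x := by
  have h1 : Yosida.comap (eta A.toBAL) (pointIdeal (X := vietoris.obj (yosida A.toBAL))
      (valueSet (Y := yosida A.toBAL) (strF (hLift A.box A.isModal)) x)) =
        Yosida.comap (hLift A.box A.isModal) x :=
    congrArg (fun k : yosida A.toBAL ⟶ yosida (hObj A.toBAL) => k x)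
      (strF_comp (hLift A.box A.isModal))
  refine infOrOne_injective fun a => (ev_comap_eta A.toBAL _ a).symm.trans ?_
  refine (congrArg (fun N : Yosida (hObj A.toBAL) => N.ev (hGen A.toBAL a)) h1).trans ?_
  refine (Yosida.ev_comap _ _ _).trans ?_
  rw [hLift_gen]
  exact (infOrOne_lowerSet x A.isModal a).symm

theorem boxRel_iff (A : MBAL.{u}) (x y : Yosida A.toBAL) :
    boxRel A x y ↔ y ∈ valueSet (Y := yosida A.toBAL) (strF (hLift A.box A.isModal)) x := by
  rw [strF_hLift]
  constructor
  · intro h a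
    have h0 : x.ev (A.box 0) = 0 := x.ev_eq_zero.2 (h 0 le_rfl y.1.zero_mem)
    have h1 : (a + algebraMap ℝ A.toBAL (-y.ev a)) ⊔ 0 ∈ y := by
      rw [← y.ev_eq_zero, y.ev_posPart, y.ev_add, y.ev_algebraMap, add_neg_cancel, max_self]
    have h2 := x.ev_eq_zero.2 (h _ le_sup_right h1)
    rw [modal_posPart x A.isModal, modal_add_real x A.isModal h0] at h2
    have := h2 ▸ le_max_left (x.ev (A.box a) + -y.ev a) 0
    linarith
  · intro h a ha hay
    have h1 := h a
    rw [y.ev_eq_zero.2 hay] at h1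
    rw [← x.ev_eq_zero]
    have h2 := modal_posPart x A.isModal a
    rw [sup_eq_left.2 ha] at h2
    exact le_antisymm h1 (h2 ▸ le_max_right _ _)

theorem boxRel_eq (A : MBAL.{u}) : boxRel A = fun x y =>
    y ∈ valueSet (Y := yosida A.toBAL) (strF (hLift A.box A.isModal)) x := by
  funext x y
  exact propext (boxRel_iff A x y)

theorem isContinuousRel_boxRel (A : MBAL.{u}) : IsContinuousRel (boxRel A) :=
  boxRel_eq A ▸ isContinuousRel_of_coalg (strF (hLift A.box A.isModal))

/-- The contravariant functor `Y : mbaℓ → KHF`, `(A, □) ↦ (Y_A, R_□)`, `α ↦ α⁻¹`. -/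
def functorY : MBAL.{u} ⥤ KHF.{u}ᵒᵖ where
  obj A := Opposite.op ⟨yosida A.toBAL, boxRel A, isContinuousRel_boxRel A⟩
  map {A B} f := Quiver.Hom.op
    { toHom := yosidaMap f.toHom
      image_rel := fun x => by
        have := (functorS.map (functorF.map (functorN.map f)).unop).image_rel x
        simp only [boxRel_eq]
        exact this }

/-- `(□_R f)(x) = inf f(R[x])` if `R[x] ≠ ∅`, and `(□_R f)(x) = 1` otherwise. -/
noncomputable def relBox (X : KHF.{u}) (f : C(X.space, ℝ)) : C(X.space, ℝ) :=
  ⟨fun x => infOrOne f {y | X.rel x y},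
    (continuous_infOrOne f).comp (strT X).hom.hom.continuous⟩

theorem isModalMap_relBox (X : KHF.{u}) :
    IsModalMap (A := contAlg X.space) (B := contAlg X.space) (relBox X) :=
  (isModalMap_boxVietoris X.space).hom_comp (contMap (strT X))

/-- The contravariant functor `C : KHF → mbaℓ`, `(X, R) ↦ (C(X), □_R)`, `φ ↦ (f ↦ f ∘ φ)`. -/
noncomputable def functorC : KHF.{u}ᵒᵖ ⥤ MBAL.{u} where
  obj X := ⟨contAlg X.unop.space, relBox X.unop, isModalMap_relBox X.unop⟩
  map {X Y} φ :=
    { toHom := contMap φ.unop.toHom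
      map_box := fun f => ContinuousMap.ext fun x => by
        let f' : C(X.unop.space, ℝ) := f
        change infOrOne f' {z | X.unop.rel (φ.unop.toHom x) z} =
          infOrOne (f' ∘ φ.unop.toHom) {y | Y.unop.rel x y}
        rw [← φ.unop.image_rel, infOrOne_image] }

end ModalBal

open CategoryTheory ModalBal

namespace ModalBal

/-! ### Uniform completeness -/

/-! The theorem is Gelfand duality enriched by one representation result. Fix a modal algebra `A`
and a maximal `ℓ`-ideal `x`, and look at the functional `a ↦ x(□a)`. Since `x(□0)` is idempotent it
is `0` or `1`. If it is `1`, the functional is constantly `1`. If it is `0`, the functional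
preserves finite meets, real translations, nonnegative real multiples and positive parts, and it is
then an infimum over a closed set: `x(□a) = inf {y(a) : y ∈ K}`, where `K` consists of the `y` with
`x(□b) ≤ y(b)` for all `b`. In the first case `K` is empty, which is what the default value `1` of
an infimum over `∅` records. This is `infOrOne_lowerSet`. Its core is that the infimum is attained
(`exists_mem_lowerSet`): otherwise compactness yields `c`, `d` with `x(□c) = x(□d) = 0` and `max(-d,
c) ≥ δ > 0` everywhere, so `δ(d + δ)⁺ ≤ m c⁺` for some real `m ≥ 0`, and applying the functional
gives `δ² ≤ 0`.

The closed set `K` is exactly `R_□[x]`, and a closed set of maximal `ℓ`-ideals is determined by its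
infima (`infOrOne_injective`), because elements of `A` separate points from closed sets. Hence the
representation says both that `ζ_A` commutes with `□` and, applied to `C(X)` with `□_R`, that `ε_X`
carries `R[x]` onto the set of successors of `ε_X(x)`. Naturality and the triangle identities
concern only underlying algebras and spaces, where they reduce to computing values at points.

The counit is invertible since `ε_X` is a homeomorphism. The unit is injective because maximal
`ℓ`-ideals detect the order of an archimedean algebra. Its image is uniformly dense by
Stone–Weierstrass, so it is surjective when `A` is uniformly complete. Conversely `C(X)` is
uniformly complete, because its `ℓ`-algebra norm is the sup norm.

For the factorizations, `H(A)` is universal among modal maps out of `A` and its Yosida space is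
`V(Y_A)`. Under this identification the coalgebra of `(A, □)` sends `x` to the closed set `K` above,
and the algebra of `(X, R)` sends `□_f` to `□_R f`. -/

/-- This is surjectivity of `ε_X`, rephrased in terms of values. It turns bounds over all maximal
`ℓ`-ideals of `C(X)` into pointwise bounds on `X`. -/
theorem exists_ev_eq {X : CompHaus.{u}} (M : Yosida (contAlg X)) :
    ∃ x : X, ∀ f : C(X, ℝ), M.ev (f : contAlg X) = f x := by
  obtain ⟨x, hx⟩ := (ConcreteCategory.bijective_of_isIso (epsilon X)).2 M
  obtain rfl : pointIdeal x = M := hx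
  exact ⟨x, fun f => zeta_epsilon f x⟩

/-- Both norms are suprema of absolute values, one over maximal `ℓ`-ideals and one over points, and
`ε_X` identifies the two index sets. -/
theorem balNorm_contAlg {X : CompHaus.{u}} (f : C(X, ℝ)) : balNorm f = ‖f‖ := by
  refine le_antisymm (balNorm_le (A := contAlg X) (norm_nonneg f) fun M => ?_) ?_
  · obtain ⟨x, hx⟩ := exists_ev_eq M
    rw [hx f]
    exact f.norm_coe_le_norm x
  · have h : ∀ x : X, ‖f x‖ ≤ balNorm f := fun x => by
      have := abs_ev_le_balNorm (A := contAlg X) (pointIdeal x) f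
      rwa [zeta_epsilon] at this
    rcases isEmpty_or_nonempty X with hX | ⟨⟨x⟩⟩
    -- On the empty space every real number, negative ones included, bounds `|f|`. The infimum of
    -- the whole real line is `0` by convention, which happens to agree with the sup norm.
    · have hf : f = 0 := ContinuousMap.ext fun x => hX.elim x
      have : {r : ℝ | |f| ≤ r • (1 : C(X, ℝ))} = Set.univ :=
        Set.eq_univ_of_forall fun r x => hX.elim x
      rw [balNorm, this, Real.sInf_univ, hf, norm_zero]
    · exact (ContinuousMap.norm_le f ((norm_nonneg _).trans (h x))).2 h

/-- A uniform limit of continuous functions is continuous. Completeness for the sup norm transfers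
in both directions through `balNorm_contAlg`. -/
theorem isUniformlyComplete_contAlg (X : CompHaus.{u}) : IsUniformlyComplete (contAlg X) := by
  intro (s : ℕ → C(X, ℝ)) hs
  have hc : CauchySeq s := by
    rw [Metric.cauchySeq_iff]
    intro ε hε
    obtain ⟨N, hN⟩ := hs ε hε
    refine ⟨N, fun m hm n hn => ?_⟩
    rw [dist_eq_norm, ← balNorm_contAlg]
    exact hN m hm n hn
  have hcomplete : ∀ (Y : Type u) [TopologicalSpace Y] [CompactSpace Y],
      CompleteSpace C(Y, ℝ) := fun _ => inferInstance
  have := hcomplete X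
  obtain ⟨f, hf⟩ := cauchySeq_tendsto_of_complete hc
  refine ⟨f, fun ε hε => ?_⟩
  obtain ⟨N, hN⟩ := Metric.tendsto_atTop.1 hf ε hε
  refine ⟨N, fun n hn => ?_⟩
  have := hN n hn
  rw [dist_eq_norm, ← balNorm_contAlg] at this
  exact this

/-! ### Bijectivity of the Gelfand unit -/

/-- This is where the archimedean axiom enters: through `eq_of_ev`, it makes the intersection of all
maximal `ℓ`-ideals zero. -/
theorem zeta_injective (A : BAL.{u}) : Function.Injective (zeta A).hom := fun _ _ h =>
  eq_of_ev fun M => congrArg (fun f : C(Yosida A, ℝ) => f M) h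

/-- Stone–Weierstrass applies to the image of `ζ_A`. This unital subalgebra separates points because
a maximal `ℓ`-ideal is determined by the values of all elements at it. -/
theorem exists_zeta_near (A : BAL.{u}) (f : C(Yosida A, ℝ)) {ε : ℝ} (hε : 0 < ε) :
    ∃ a : A, ∀ M : Yosida A, |M.ev a - f M| < ε := by
  let S : Subalgebra ℝ C(Yosida A, ℝ) := AlgHom.range (zeta A).hom
  have hS : S.SeparatesPoints := fun M N hne => by
    by_contra! h
    exact hne (Yosida.ext_ev fun a => h _ ⟨_, ⟨a, rfl⟩, rfl⟩)
  obtain ⟨⟨_, a, rfl⟩, ha⟩ :=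
    ContinuousMap.exists_mem_subalgebra_near_continuousMap_of_separatesPoints S hS f ε hε
  exact ⟨a, fun M => (ContinuousMap.norm_coe_le_norm _ M).trans_lt ha⟩

/-- Approximants `s n` of `f` within `1/(n+1)` are uniformly close to one another at all maximal
`ℓ`-ideals, hence Cauchy in the norm of `A`. Their limit in `A` has the same value as `f` at every
maximal `ℓ`-ideal, since evaluation is bounded by the norm. -/
theorem zeta_surjective {A : BAL.{u}} (hA : IsUniformlyComplete A) :
    Function.Surjective (zeta A).hom := by
  intro (f : C(Yosida A, ℝ))
  choose s hs using fun n : ℕ => exists_zeta_near A f (Nat.one_div_pos_of_nat (α := ℝ) (n := n))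
  have hs' : ∀ ε : ℝ, 0 < ε → ∃ N, ∀ n ≥ N, ∀ M : Yosida A, |M.ev (s n) - f M| < ε :=
    fun ε hε => by
      obtain ⟨N, hN⟩ := exists_nat_one_div_lt hε
      exact ⟨N, fun n hn M => (hs n M).trans ((Nat.one_div_le_one_div hn).trans_lt hN)⟩
  obtain ⟨a, ha⟩ := hA s fun ε hε => by
    -- Two approximants within `ε/4` of `f` differ by at most `ε/2` everywhere. As `balNorm_le`
    -- gives only a non-strict bound on the norm, the remaining `ε/2` secures the strict inequality.
    obtain ⟨N, hN⟩ := hs' (ε / 4) (by positivity)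
    refine ⟨N, fun m hm n hn => (balNorm_le (half_pos hε).le fun M => ?_).trans_lt
      (half_lt_self hε)⟩
    have h1 := abs_lt.1 (hN m hm M)
    have h2 := abs_lt.1 (hN n hn M)
    rw [M.ev_sub, abs_le]
    constructor <;> linarith [h1.1, h1.2, h2.1, h2.2]
  refine ⟨a, ContinuousMap.ext fun M : Yosida A => ?_⟩
  change M.ev a = f M
  refine eq_of_abs_sub_le_all fun ε hε => ?_
  obtain ⟨N, hN⟩ := ha (ε / 2) (half_pos hε)
  obtain ⟨K, hK⟩ := hs' (ε / 2) (half_pos hε)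
  -- At an index beyond both thresholds, `s n` is within `ε/2` of `f` by its choice and within `ε/2`
  -- of `a` by convergence.
  have h1 := abs_lt.1 (hK (max N K) (le_max_right _ _) M)
  have h2 := (abs_ev_le_balNorm M _).trans_lt (hN (max N K) (le_max_left _ _))
  rw [M.ev_sub, abs_lt] at h2
  rw [abs_le]
  constructor <;> linarith [h1.1, h1.2, h2.1, h2.2]

/-! ### Isomorphisms -/

/-- All the structure consists of operations. The inverse map therefore preserves `⊔`, `⊓` and `□`,
as one sees by applying the injective map `f` to both sides of each identity. -/
theorem MBAL.isIso_of_bijective {A B : MBAL.{u}} (f : A ⟶ B)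
    (hf : Function.Bijective f.toHom.hom) : IsIso f := by
  let e : A.toBAL ≃ₐ[ℝ] B.toBAL := AlgEquiv.ofBijective f.toHom.hom hf
  have he : ∀ b, f.toHom.hom (e.symm b) = b := e.apply_symm_apply
  let g : B ⟶ A :=
    { toHom :=
        { hom := e.symm
          map_sup := fun a b => hf.1 <| by
            change f.toHom.hom (e.symm _) = f.toHom.hom (e.symm _ ⊔ e.symm _)
            rw [f.toHom.map_sup, he, he, he]
          map_inf := fun a b => hf.1 <| by
            change f.toHom.hom (e.symm _) = f.toHom.hom (e.symm _ ⊓ e.symm _)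
            rw [f.toHom.map_inf, he, he, he] }
      map_box := fun b => hf.1 <| by
        change f.toHom.hom (e.symm _) = f.toHom.hom (A.box (e.symm b))
        rw [f.map_box, he, he] }
  exact ⟨g, MBAL.hom_ext (BAL.hom_ext e.symm_apply_apply), MBAL.hom_ext (BAL.hom_ext he)⟩

/-- The bounded morphism condition is an equality of sets, not an inclusion, so it is inherited by
the inverse of an invertible map. This reduces invertibility of the counit to that of the continuous
map `ε_X`. -/
theorem KHF.isIso_of_isIso {X Y : KHF.{u}} (f : X ⟶ Y) [IsIso f.toHom] : IsIso f := by
  have h1 : ∀ x, inv f.toHom (f.toHom x) = x := fun x =>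
    congrArg (fun k : X.space ⟶ X.space => k x) (IsIso.hom_inv_id f.toHom)
  have h2 : ∀ y, f.toHom (inv f.toHom y) = y := fun y =>
    congrArg (fun k : Y.space ⟶ Y.space => k y) (IsIso.inv_hom_id f.toHom)
  let g : Y ⟶ X :=
    { toHom := inv f.toHom
      image_rel := fun y => by
        -- With `x = f⁻¹(y)` the condition reads `f(R[x]) = S[y]`. Taking images under `f⁻¹` gives
        -- `R[f⁻¹(y)] = f⁻¹(S[y])`.
        have := f.image_rel (inv f.toHom y)
        rw [h2] at this
        rw [← this, Set.image_image]
        simp only [h1, Set.image_id'] }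
  exact ⟨g, KHF.hom_ext (IsIso.hom_inv_id f.toHom), KHF.hom_ext (IsIso.inv_hom_id f.toHom)⟩

/-! ### The dual adjunction -/

/-- This puts `R_□[x]` in the form to which `infOrOne_lowerSet` applies. The relation tests only
nonnegative elements of `y`, but testing `(a - y(a))⁺` recovers `x(□a) ≤ y(a)` for arbitrary `a`. -/
theorem setOf_boxRel_eq_lowerSet (A : MBAL.{u}) (x : Yosida A.toBAL) :
    {y | boxRel A x y} = lowerSet A.box x := by
  refine Set.ext fun y => (boxRel_iff A x y).trans ?_
  rw [strF_hLift]
  rfl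

/-- `ζ_A` as a morphism of `mbaℓ`. -/
noncomputable def zetaModal (A : MBAL.{u}) : A ⟶ functorC.obj (functorY.obj A) where
  toHom := zeta A.toBAL
  map_box a := ContinuousMap.ext fun x : Yosida A.toBAL => by
    -- Commutation with `□` at the point `x` is exactly the representation of `a ↦ x(□a)` as an
    -- infimum over `R_□[x]`. The case of no successors is covered by the default value `1`.
    change x.ev (A.box a) = infOrOne (fun y : Yosida A.toBAL => y.ev a) {y | boxRel A x y}
    rw [setOf_boxRel_eq_lowerSet, infOrOne_lowerSet x A.isModal]

/-- Both sides are compact sets of maximal `ℓ`-ideals of `C(X)`, so it suffices to compare the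
infima of every `f` over them. Both infima equal `(□_R f)(x)`: on the left by the definition of
`□_R`, on the right by the representation of a modal functional. -/
theorem epsilon_image_rel (X : KHF.{u}) (x : X.space) :
    pointIdeal '' {y | X.rel x y} =
      {z | boxRel (functorC.obj (Opposite.op X)) (pointIdeal x) z} := by
  refine Eq.trans ?_ (setOf_boxRel_eq_lowerSet (functorC.obj (Opposite.op X)) (pointIdeal x)).symm
  -- The image is compact because `R[x]` is closed in a compact space and `ε_X` is continuous. This
  -- is what allows `infOrOne_injective` to be used.
  let K : TopologicalSpace.Compacts (Yosida (contAlg X.space)) :=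
    ⟨pointIdeal '' {y | X.rel x y}, (X.isContinuous.isClosed_image x).isCompact.image
      (epsilon X.space).hom.hom.continuous⟩
  have hK : K = lowerCompact (A := contAlg X.space) (B := contAlg X.space) (relBox X)
      (pointIdeal x) := by
    refine infOrOne_injective fun f => ?_
    refine Eq.trans ?_ (infOrOne_lowerSet _ (isModalMap_relBox X) f).symm
    refine (infOrOne_image _ _).trans (Eq.trans ?_ (zeta_epsilon (relBox X f) x).symm)
    exact congrArg (infOrOne · {y | X.rel x y}) (funext (zeta_epsilon f))
  exact congrArg TopologicalSpace.Compacts.carrier hK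

/-- `ε_X` as a morphism of compact Hausdorff frames. -/
noncomputable def epsilonFrame (X : KHF.{u}) :
    X ⟶ (functorY.obj (functorC.obj (Opposite.op X))).unop where
  toHom := epsilon X.space
  image_rel := epsilon_image_rel X

/-- The dual adjunction between `mbaℓ` and `KHF`. -/
noncomputable def dualAdjunction : functorY.{u} ⊣ functorC.{u} :=
  Adjunction.mkOfUnitCounit
    { unit :=
        { app := zetaModal
          -- At a point `M`, naturality of the unit says that `f(a)` takes at `M` the value that `a`
          -- takes at `f⁻¹(M)`.
          naturality := fun A B f => MBAL.hom_ext <| BAL.hom_ext fun a =>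
            ContinuousMap.ext fun M : Yosida B.toBAL => (Yosida.ev_comap f.toHom M a).symm }
      counit :=
        { app := fun X => (epsilonFrame X.unop).op
          naturality := fun X Y f => Quiver.Hom.unop_inj <| KHF.hom_ext <|
            (epsilon_naturality f.unop.toHom).symm }
      left_triangle := by
        ext A
        refine Quiver.Hom.unop_inj <| KHF.hom_ext ?_
        ext M
        -- The composite sends `M` to `ζ_A⁻¹(ε(M))`. The value of `a` there is that of the function
        -- `ζ_A(a)` at `M`, which is the value of `a` at `M`; so the ideal is `M` itself.
        exact Yosida.ext_ev fun a => (Yosida.ev_comap (zeta A.toBAL) _ a).trans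
          (zeta_epsilon ((zeta A.toBAL).hom a) M)
      right_triangle := by
        ext X f
        -- The remaining triangle identity is `ζ(f)(ε(x)) = f(x)`.
        exact ContinuousMap.ext fun x : X.unop.space => zeta_epsilon f x }

/-! ### Restriction to a dual equivalence -/

instance (X : KHF.{u}ᵒᵖ) : IsIso (dualAdjunction.counit.app X) := by
  have : IsIso (epsilonFrame X.unop).toHom := inferInstanceAs (IsIso (epsilon X.unop.space))
  have := KHF.isIso_of_isIso (epsilonFrame X.unop)
  exact inferInstanceAs (IsIso (epsilonFrame X.unop).op)

theorem isIso_unit {A : MBAL.{u}} (hA : MBAL.uniformlyComplete A) :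
    IsIso (dualAdjunction.unit.app A) :=
  MBAL.isIso_of_bijective (zetaModal A) ⟨zeta_injective _, zeta_surjective hA⟩

theorem uniformlyComplete_functorC (X : KHF.{u}ᵒᵖ) :
    MBAL.uniformlyComplete (functorC.obj X) := isUniformlyComplete_contAlg X.unop.space

/-- The restriction of the dual adjunction to `mubaℓ`. -/
noncomputable def restrictedAdjunction : MBAL.uniformlyComplete.{u}.ι ⋙ functorY ⊣
    MBAL.uniformlyComplete.lift functorC uniformlyComplete_functorC :=
  -- Only the algebra side is cut down, since `C` already lands among uniformly complete algebras.
  -- The frame side is restricted along the identity functor, and the comparison isomorphisms are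
  -- identities.
  dualAdjunction.restrictFullyFaithful MBAL.uniformlyComplete.fullyFaithfulι
    (Functor.FullyFaithful.id _) (Iso.refl _) (Iso.refl _)

/-- The inclusion of `mubaℓ` is fully faithful, hence reflects isomorphisms, and it sends the
restricted unit to the original one up to identity isomorphisms. -/
instance (A : MUBAL.{u}) : IsIso (restrictedAdjunction.unit.app A) := by
  have := isIso_unit A.property
  have h : IsIso (MBAL.uniformlyComplete.ι.map (restrictedAdjunction.unit.app A)) := by
    rw [restrictedAdjunction, Adjunction.map_restrictFullyFaithful_unit_app]
    dsimp
    infer_instance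
  exact isIso_of_reflects_iso _ MBAL.uniformlyComplete.ι

instance (X : KHF.{u}ᵒᵖ) : IsIso (restrictedAdjunction.counit.app X) := by
  have h : IsIso ((𝟭 KHF.{u}ᵒᵖ).map (restrictedAdjunction.counit.app X)) := by
    rw [restrictedAdjunction, Adjunction.map_restrictFullyFaithful_counit_app]
    dsimp
    infer_instance
  exact h

/-! ### Factorizations through `Alg(H)` and `Coalg(V)` -/

/-- Equality of functors compares morphisms whose endpoints are equal but carry relations given by
different expressions, so heterogeneous equality is needed. Once the relations are identified, a
frame morphism is determined by its underlying map. -/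
theorem KHF.hom_heq {X Y : CompHaus.{u}} {R R' : X → X → Prop} {S S' : Y → Y → Prop}
    (hR : IsContinuousRel R) (hR' : IsContinuousRel R') (hS : IsContinuousRel S)
    (hS' : IsContinuousRel S') (h : R = R') (h' : S = S') (f : KHF.mk X R hR ⟶ KHF.mk Y S hS)
    (g : KHF.mk X R' hR' ⟶ KHF.mk Y S' hS') (hfg : f.toHom = g.toHom) : f.op ≍ g.op := by
  subst h h'
  exact heq_of_eq (congrArg _ (KHF.hom_ext hfg))

/-- The algebraic counterpart of `KHF.hom_heq`: the underlying algebras agree on the nose, and only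
the modal operators have to be identified. -/
theorem MBAL.hom_heq {A B : BAL.{u}} {r r' : A → A} {s s' : B → B}
    (hr : IsModalMap r) (hr' : IsModalMap r') (hs : IsModalMap s)
    (hs' : IsModalMap s') (h : r = r') (h' : s = s') (f : MBAL.mk A r hr ⟶ MBAL.mk B s hs)
    (g : MBAL.mk A r' hr' ⟶ MBAL.mk B s' hs') (hfg : f.toHom = g.toHom) : f ≍ g := by
  subst h h'
  exact heq_of_eq (MBAL.hom_ext hfg)

/-- On objects the spaces coincide and `boxRel_eq` identifies the relations: the coalgebra attached
to `(A, □)` sends `x` to the closed set whose infima are the numbers `x(□a)`, and that set is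
`R_□[x]`. On morphisms both functors are `α ↦ α⁻¹`. -/
theorem functorN_comp_functorF_comp_functorS : functorN.{u} ⋙ functorF ⋙ functorS.op = functorY := by
  refine Functor.hext (fun A => ?_) fun A B f => ?_
  · refine congrArg Opposite.op ?_
    change KHF.mk _ _ _ = KHF.mk _ _ _
    congr 1
    exact (boxRel_eq A).symm
  -- The relation on `Y_B` comes first because `f : A ⟶ B` induces a map `Y_B → Y_A`.
  · exact KHF.hom_heq _ _ _ _ (boxRel_eq B).symm (boxRel_eq A).symm
      ((functorS.map (functorF.map (functorN.map f)).unop)) (functorY.map f).unop rfl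

/-- On generators, `η_{C(X)}` followed by restriction along `V(ε_X)` sends `□_f` to `K ↦ inf f(K)`.
Composing with `x ↦ R[x]` turns this into `x ↦ inf f(R[x])`, with the same value `1` when `R[x]` is
empty. -/
theorem strG_strT (X : KHF.{u}) :
    (fun f : contAlg X.space => (strG (strT X)).hom (hGen (contAlg X.space) f)) = relBox X := by
  funext f
  rw [strG_gen]
  rfl

theorem functorT_comp_functorG_comp_functorM : functorT.{u}.op ⋙ functorG ⋙ functorM = functorC := by
  refine Functor.hext (fun X => ?_) fun X Y f => ?_
  · change MBAL.mk _ _ _ = MBAL.mk _ _ _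
    congr 1
    exact strG_strT X.unop
  · exact MBAL.hom_heq _ _ _ _ (strG_strT X.unop) (strG_strT Y.unop)
      (functorM.map (functorG.map (functorT.op.map f))) (functorC.map f) rfl

end ModalBal

theorem mainTheorem6 :
    (∃ adj : functorY.{u} ⊣ functorC.{u},
      (∀ A : MBAL.{u}, (adj.unit.app A).toHom = zeta A.toBAL) ∧
      (∀ X : KHF.{u}ᵒᵖ, (adj.counit.app X).unop.toHom = epsilon X.unop.space) ∧
      (∀ A : MBAL.{u}, MBAL.uniformlyComplete A → IsIso (adj.unit.app A)) ∧
      (∀ X : KHF.{u}ᵒᵖ, IsIso (adj.counit.app X))) ∧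
    (∃ (hC : ∀ X : KHF.{u}ᵒᵖ, MBAL.uniformlyComplete (functorC.{u}.obj X))
      (e : MUBAL.{u} ≌ KHF.{u}ᵒᵖ),
      e.functor = MBAL.uniformlyComplete.ι ⋙ functorY ∧
      e.inverse = MBAL.uniformlyComplete.lift functorC hC) ∧
    functorN.{u} ⋙ functorF ⋙ functorS.op = functorY ∧
    functorT.{u}.op ⋙ functorG ⋙ functorM = functorC := by
  -- The components of the unit and counit are `ζ_A` and `ε_X` by construction. An adjunction whose
  -- unit and counit are invertible is an equivalence with the same two functors, so their
  -- identification is also definitional.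
  refine ⟨⟨dualAdjunction, fun _ => rfl, fun _ => rfl, fun _ => isIso_unit, inferInstance⟩,
    ⟨uniformlyComplete_functorC, restrictedAdjunction.toEquivalence, rfl, rfl⟩,
    functorN_comp_functorF_comp_functorS, functorT_comp_functorG_comp_functorM⟩
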